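/- Let $(I,H)$ be a quiver with maps $\mathrm{out},\mathrm{in}\colon H\to I$, a fixed-point-free involution $h\mapsto\bar h$ of $H$ with $\mathrm{out}(\bar h)=\mathrm{in}(h)$, and an orientation $\Omega\subset H$, i.e. $H=\Omega\sqcup\overline\Omega$. Assume that the number $c_{ij}$ of arrows in $H$ from $i$ to $j$ is finite for all $i,j\in I$. Put $\varepsilon(h)=1$ for $h\in\Omega$ and $\varepsilon(h)=-1$ for $h\in\overline\Omega$. For a finite-dimensional $I$-graded complex vector space $V=\bigoplus_i V_i$ of dimension vector $\alpha$, let $X_\alpha=\bigoplus_{h\in H}\mathrm{Hom}(V_{\mathrm{out}(h)},V_{\mathrm{in}(h)})$ with the symplectic form $\omega(B,B')=\sum_{h}\varepsilon(h)\,\mathrm{Tr}(B_{\bar h}B'_h)$, and let $\mathcal N_\alpha\subset X_\alpha$ be the set of all $B=(B_h)_{h\in H}$ such that (i) there is an $I$-graded complete flag $0=F_0\subset F_1\subset F_2\subset\cdots$ of $V$ with $B_h(F_k)\subset F_k$ for every loop $h\in\overline\Omega$ and $B_h(F_k)\subset F_{k-1}$ for every other $h\in H$ (for all $k$, where $F_{-1}=0$);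 (ii) $\mu_i(B)=\sum_{h\in H,\ \mathrm{out}(h)=i}\varepsilon(h)B_{\bar h}B_h=0$ in $\mathrm{End}(V_i)$ for every $i\in I$; (iii) $B_h$ is regular semisimple (its eigenvalues, counted with algebraic multiplicity, are pairwise distinct) for every loop $h\in\overline\Omega$. A subvariety of $X_\alpha$ is called Lagrangian if $\omega$ vanishes on its tangent space at each smooth point and each of its irreducible components has dimension $\frac12\dim X_\alpha$. Then for every $l\ge 1$ and $i\in I$ the variety $\mathcal N_{l\alpha_i}$ (the case $\dim V_i=l$ and $V_j=0$ for $j\ne i$) is irreducible, for the Zariski topology, and Lagrangian. Moreover, if $c_{ii}=2$, then $\mathcal N_{l\alpha_i}$ is isomorphic, as a variety, to the locus of regular semisimple elements of $\mathfrak{gl}(l)=\mathfrak{gl}(l,\mathbb C)$. -/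

import Mathlib

noncomputable section

/-! ## Algebraic geometry of subsets of a finite-dimensional complex vector space -/

/-- The restrictions to `S` of the polynomial functions on the complex vector space `W`:
the algebra of functions on `S` generated by the linear forms of `W`. For a locally closed `S`,
this is the coordinate ring of the Zariski closure of `S`. -/
def coordRing {W : Type*} [AddCommGroup W] [Module ℂ W] (S : Set W) : Subalgebra ℂ (S → ℂ) :=
  Algebra.adjoin ℂ (Set.range fun (φ : Module.Dual ℂ W) (x : S) => φ (x : W))

/-- The algebra of polynomial functions on `W`. -/
def polyFun (W : Type*) [AddCommGroup W] [Module ℂ W] : Subalgebra ℂ (W → ℂ) :=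
  Algebra.adjoin ℂ (Set.range fun (φ : Module.Dual ℂ W) (x : W) => φ x)

/-- The Zariski topology of `W`: its basic open sets are `{x | f x ≠ 0}`, `f` polynomial. -/
@[reducible] def zariskiTopology (W : Type*) [AddCommGroup W] [Module ℂ W] : TopologicalSpace W :=
  TopologicalSpace.generateFrom {U | ∃ f ∈ polyFun W, U = {x | f x ≠ 0}}

/-- `S` is (nonempty and) irreducible for the Zariski topology. -/
def IsZariskiIrreducible {W : Type*} [AddCommGroup W] [Module ℂ W] (S : Set W) : Prop :=
  letI := zariskiTopology W
  IsIrreducible S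

/-- `Z` is an irreducible component of `S`: a maximal irreducible subset. -/
def IsZariskiComponent {W : Type*} [AddCommGroup W] [Module ℂ W] (S Z : Set W) : Prop :=
  Maximal (fun T : Set W => T ⊆ S ∧ IsZariskiIrreducible T) Z

/-- The irreducible variety `Z` has dimension `n`: its coordinate ring has transcendence
degree `n` over `ℂ`. -/
def HasVarietyDim {W : Type*} [AddCommGroup W] [Module ℂ W] (Z : Set W) (n : ℕ) : Prop :=
  Algebra.trdeg ℂ (coordRing Z) = n

/-- A polynomial function has a derivative at each point, linear in the direction. -/
theorem polyFun_hasLineDerivAt {W : Type*} [AddCommGroup W] [Module ℂ W] {f : W → ℂ}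
    (hf : f ∈ polyFun W) (x : W) :
    ∃ L : W →ₗ[ℂ] ℂ, ∀ v, HasLineDerivAt ℂ f (L v) x v := by
  induction hf using Algebra.adjoin_induction with
  | mem f hf =>
    obtain ⟨φ, rfl⟩ := hf
    refine ⟨φ, fun v => ?_⟩
    simp only [HasLineDerivAt, map_add, map_smul, smul_eq_mul]
    simpa using ((hasDerivAt_id (0 : ℂ)).mul_const (φ v)).const_add (φ x)
  | algebraMap r => exact ⟨0, fun v => by simpa [HasLineDerivAt] using hasDerivAt_const (0 : ℂ) r⟩
  | add f g _ _ ihf ihg =>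
    obtain ⟨L, hL⟩ := ihf
    obtain ⟨M, hM⟩ := ihg
    exact ⟨L + M, fun v => HasDerivAt.add (hL v) (hM v)⟩
  | mul f g _ _ ihf ihg =>
    obtain ⟨L, hL⟩ := ihf
    obtain ⟨M, hM⟩ := ihg
    refine ⟨g x • L + f x • M, fun v => ?_⟩
    have h := HasDerivAt.mul (hL v) (hM v)
    have e : L v * g (x + (0 : ℂ) • v) + f (x + (0 : ℂ) • v) * M v =
        (g x • L + f x • M) v := by
      simp [mul_comm]
    rw [e] at h
    exact h

/-- The Zariski tangent space of `S` at `x`: the directions in which every polynomial function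
that vanishes on `S` has derivative zero at `x`. -/
def zariskiTangent {W : Type*} [AddCommGroup W] [Module ℂ W] (S : Set W) (x : W) :
    Submodule ℂ W where
  carrier := {v | ∀ f ∈ polyFun W, (∀ y ∈ S, f y = 0) → lineDeriv ℂ f x v = 0}
  zero_mem' := fun f _ _ => lineDeriv_zero
  add_mem' := by
    intro v w hv hw f hf h
    obtain ⟨L, hL⟩ := polyFun_hasLineDerivAt hf x
    have h1 := hv f hf h
    have h2 := hw f hf h
    rw [(hL _).lineDeriv] at h1 h2 ⊢
    rw [map_add, h1, h2, add_zero]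
  smul_mem' := by
    intro c v hv f hf h
    obtain ⟨L, hL⟩ := polyFun_hasLineDerivAt hf x
    have h1 := hv f hf h
    rw [(hL _).lineDeriv] at h1 ⊢
    rw [map_smul, h1, smul_zero]

/-- `x` is a smooth point of `S`: the tangent space at `x` is no larger than the local dimension
of `S` at `x`. (The dimension of every component through `x` is at most that of the tangent space,
so it is enough that one component attains it.) -/
def IsSmoothPoint {W : Type*} [AddCommGroup W] [Module ℂ W] (S : Set W) (x : W) : Prop :=
  ∃ Z : Set W, IsZariskiComponent S Z ∧ x ∈ Z ∧
    HasVarietyDim Z (Module.finrank ℂ (zariskiTangent S x))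

/-- `S` is isotropic for `ω`: so is its tangent space at each smooth point. -/
def IsIsotropicVariety {W : Type*} [AddCommGroup W] [Module ℂ W] (ω : W → W → ℂ)
    (S : Set W) : Prop :=
  ∀ x, IsSmoothPoint S x → ∀ v ∈ zariskiTangent S x, ∀ w ∈ zariskiTangent S x, ω v w = 0

/-- `S` is Lagrangian in the symplectic vector space `(W, ω)`: it is isotropic, and each of its
irreducible components has half the dimension of `W`. -/
def IsLagrangianVariety {W : Type*} [AddCommGroup W] [Module ℂ W] (ω : W → W → ℂ)
    (S : Set W) : Prop :=
  IsIsotropicVariety ω S ∧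
    ∀ Z, IsZariskiComponent S Z → ∃ n : ℕ, HasVarietyDim Z n ∧ 2 * n = Module.finrank ℂ W

/-- `g` is a regular function on `S`: near each point it is a quotient of polynomials. -/
def IsRegularFun {W : Type*} [AddCommGroup W] [Module ℂ W] (S : Set W) (g : S → ℂ) : Prop :=
  ∀ x : S, ∃ p ∈ polyFun W, ∃ q ∈ polyFun W, q x ≠ 0 ∧ ∀ y : S, q y ≠ 0 → g y = p y / q y

/-- `F` is a morphism of varieties: its coordinates are regular functions. -/
def IsRegularMap {W W' : Type*} [AddCommGroup W] [Module ℂ W] [AddCommGroup W'] [Module ℂ W']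
    (S : Set W) (T : Set W') (F : S → T) : Prop :=
  ∀ φ : Module.Dual ℂ W', IsRegularFun S fun x => φ (F x)

/-- `S` and `T` are isomorphic varieties. -/
def IsomorphicVarieties {W W' : Type*} [AddCommGroup W] [Module ℂ W] [AddCommGroup W']
    [Module ℂ W'] (S : Set W) (T : Set W') : Prop :=
  ∃ e : S ≃ T, IsRegularMap S T e ∧ IsRegularMap T S e.symm

/-- An endomorphism of a finite-dimensional complex vector space is regular semisimple if its
eigenvalues, counted with algebraic multiplicity, are pairwise distinct. -/
def IsRegularSemisimple {U : Type*} [AddCommGroup U] [Module ℂ U] [FiniteDimensional ℂ U]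
    (f : U →ₗ[ℂ] U) : Prop :=
  f.charpoly.roots.Nodup

/-! ## Quivers and their representations -/

/-- A quiver `(I, H)` with an arrow-reversing involution without fixed points and an
orientation `Ω`, so that `H` is the disjoint union of `Ω` and its image under the involution.
There are finitely many arrows between any two vertices. -/
structure OrientedQuiver (I H : Type*) where
  out : H → I
  sink : H → I
  bar : H → H
  bar_bar : ∀ h, bar (bar h) = h
  bar_ne : ∀ h, bar h ≠ h
  out_bar : ∀ h, out (bar h) = sink h
  Ω : Set H
  bar_mem_iff : ∀ h, bar h ∈ Ω ↔ h ∉ Ω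
  finite_arrows : ∀ i j, {h | out h = i ∧ sink h = j}.Finite

namespace OrientedQuiver

variable {I H : Type*} (Q : OrientedQuiver I H)

theorem sink_bar (h : H) : Q.sink (Q.bar h) = Q.out h := by
  rw [← Q.out_bar, Q.bar_bar]

/-- The number `c_ij` of arrows from `i` to `j` in `H`. -/
def numArrows (i j : I) : ℕ := {h | Q.out h = i ∧ Q.sink h = j}.ncard

/-- The sign `ε(h)`: `1` on `Ω` and `-1` off `Ω`. -/
def sign (h : H) : ℂ :=
  open Classical in if h ∈ Q.Ω then 1 else -1

variable (V : I → Type*) [∀ i, AddCommGroup (V i)] [∀ i, Module ℂ (V i)]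

/-- The space `X` of all families `B_h : V_{out h} → V_{sink h}`, `h ∈ H`. When the total
dimension of `V` is finite all but finitely many of the factors are zero spaces, so that the
product is also the direct sum. -/
abbrev RepSpace := ∀ h : H, V (Q.out h) →ₗ[ℂ] V (Q.sink h)

variable {V}

/-- `B_{bar h}`, as a map from `V_{sink h}` to `V_{out h}`. -/
def barMap (B : Q.RepSpace V) (h : H) : V (Q.sink h) →ₗ[ℂ] V (Q.out h) :=
  (LinearEquiv.cast (R := ℂ) (M := V) (Q.sink_bar h)).toLinearMap ∘ₗ B (Q.bar h) ∘ₗ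
    (LinearEquiv.cast (R := ℂ) (M := V) (Q.out_bar h).symm).toLinearMap

/-- For a loop `h`, the map `B_h` as an endomorphism of `V_{out h}`. -/
def loopEnd (B : Q.RepSpace V) (h : H) (e : Q.out h = Q.sink h) :
    V (Q.out h) →ₗ[ℂ] V (Q.out h) :=
  (LinearEquiv.cast (R := ℂ) (M := V) e.symm).toLinearMap ∘ₗ B h

/-- The symplectic form `ω(B, B') = ∑_h ε(h) Tr(B_{bar h} B'_h)`. -/
def symplecticForm (B B' : Q.RepSpace V) : ℂ :=
  ∑ᶠ h : H, Q.sign h * LinearMap.trace ℂ (V (Q.out h)) (Q.barMap B h ∘ₗ B' h)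

/-- The moment map `μ_i(B) = ∑_{out h = i} ε(h) B_{bar h} B_h`, with values in `End V_i`. -/
def momentMap (B : Q.RepSpace V) (i : I) : Module.End ℂ (V i) :=
  ∑ᶠ h : {h : H // Q.out h = i}, Q.sign h •
    (LinearEquiv.cast (R := ℂ) (M := V) h.2).conj (Q.barMap B h ∘ₗ B h)

/-- `h` is a loop in the opposite orientation (the image of `Ω` under the involution). -/
def IsOppositeLoop (h : H) : Prop := Q.out h = Q.sink h ∧ h ∉ Q.Ω

variable (V) in
/-- `F_0 ⊂ F_1 ⊂ F_2 ⊂ ⋯` is an `I`-graded complete flag of `V = ⨁ V_i`: an increasing family of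
graded subspaces, where `F_k` has total dimension `k` up to `dim V`, and `F_k = V` from there. -/
def IsCompleteFlag (F : ℕ → ∀ i, Submodule ℂ (V i)) : Prop :=
  Monotone F ∧
  (∀ k ≤ ∑ᶠ i, Module.finrank ℂ (V i), ∑ᶠ i, Module.finrank ℂ (F k i) = k) ∧
  (∀ k ≥ ∑ᶠ i, Module.finrank ℂ (V i), ∀ i, F k i = ⊤)

variable (V) in
/-- The set of `B` such that `B_h` is regular semisimple for each loop `h` of the opposite
orientation. -/
def regularLocus [∀ i, FiniteDimensional ℂ (V i)] : Set (Q.RepSpace V) :=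
  {B | ∀ h (e : Q.IsOppositeLoop h), IsRegularSemisimple (Q.loopEnd B h e.1)}

/-- `B` preserves the flag `F`; only the loops of the opposite orientation may fail to be
strictly decreasing on it. (`B_h F_0 = 0` holds because `F_0 = 0`.) -/
def PreservesFlag (B : Q.RepSpace V) (F : ℕ → ∀ i, Submodule ℂ (V i)) : Prop :=
  (∀ h, Q.IsOppositeLoop h → ∀ k, (F k (Q.out h)).map (B h) ≤ F k (Q.sink h)) ∧
  (∀ h, ¬ Q.IsOppositeLoop h → ∀ k, (F (k + 1) (Q.out h)).map (B h) ≤ F k (Q.sink h))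

variable (V) in
/-- The variety `𝒩`: all `B` that preserve some graded complete flag in the above sense, are
annihilated by the moment map, and lie in the regular locus. -/
def nilVariety [∀ i, FiniteDimensional ℂ (V i)] : Set (Q.RepSpace V) :=
  {B | (∃ F, IsCompleteFlag V F ∧ Q.PreservesFlag B F) ∧ (∀ i, Q.momentMap B i = 0) ∧
    B ∈ Q.regularLocus V}

end OrientedQuiver

end

/-! When `V` lives at one vertex, a representation is a pair of families of `l × l` matrices indexed
by the loops `k ∈ Ω` at `i`: `C k` for the opposite loops (first component) and `A k` for the loops
of `Ω` (second component). Membership in `𝒩` says that in some basis all `C k` are upper triangular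
with distinct diagonal entries, all `A k` are strictly upper triangular, and `∑ [C k, A k] = 0`.

Fix one loop `k₀`. Since `C k₀` is regular semisimple and preserves the flag, the adapted basis can
be chosen to diagonalize it (`exists_flag_eigenbasis`). The commutator with a diagonal matrix with
distinct entries is invertible on strictly upper triangular matrices, so the moment equation
determines `A k₀` from the other matrices (`pairBracket_eq_zero_iff`). Hence `𝒩` consists of the
`GL(l)`-conjugates of normal forms (`mem_nilVariety_iff_pair`), and these are parametrized by an
open subset of a vector space: `l` parameters for `C k₀`, and `l²` for each other pair `(C k, A k)`.
Conjugation modulo the torus adds `l² - l`, so with `m` loops the total is `m l²`, half of `2 m l²`.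

Irreducibility: straight lines in the parameters and in the conjugating matrix join any two points,
outside finitely many times (`triangularLocus_curves`), and the identity theorem applies. Dimension:
the parametrization is an immersion (`triangularLocus_immersion`), which bounds the dimension below;
clearing its denominators gives a polynomial map with dense image (`triangularLocus_dense`), which
bounds it above. Isotropy: tangent vectors have the form `[X, b] + β` with `β` triangular. Since the
form pairs `[X, b]` with `v` to `Tr(X dμ(v))`, and `dμ` kills both kinds of vector, only the pairing
of two triangular vectors remains, and it is a trace of strictly triangular matrices
(`pairForm_eq_zero`).

If `c_ii = 2` there is only the loop `k₀`, the moment equation forces `A k₀ = 0`, and `C k₀` may be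
any regular semisimple matrix. Without loops, everything is a point. -/

open Filter Topology Matrix

/-! ### Criteria for irreducibility, dimension and the Lagrangian property. -/

section AlgebraicGeometry

variable {W T : Type*} [AddCommGroup W] [Module ℂ W]

theorem polyFun_of_dual (φ : Module.Dual ℂ W) : (fun x => φ x) ∈ polyFun W :=
  Algebra.subset_adjoin ⟨φ, rfl⟩

/-- A composite of a polynomial function with a map whose coordinates lie in a given algebra of
functions lies in that algebra. -/
theorem polyFun_comp_mem (A : Subalgebra ℂ (T → ℂ)) {Ψ : T → W}
    (hΨ : ∀ φ : Module.Dual ℂ W, (fun t => φ (Ψ t)) ∈ A) {f : W → ℂ} (hf : f ∈ polyFun W) :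
    (fun t => f (Ψ t)) ∈ A := by
  induction hf using Algebra.adjoin_induction with
  | mem f hf => obtain ⟨φ, rfl⟩ := hf; exact hΨ φ
  | algebraMap r => exact A.algebraMap_mem r
  | add f g _ _ ihf ihg => exact A.add_mem ihf ihg
  | mul f g _ _ ihf ihg => exact A.mul_mem ihf ihg

theorem polyFun_comp_differentiableAt {γ : ℂ → W} {t : ℂ}
    (hγ : ∀ φ : Module.Dual ℂ W, DifferentiableAt ℂ (fun t => φ (γ t)) t) {f : W → ℂ}
    (hf : f ∈ polyFun W) : DifferentiableAt ℂ (fun t => f (γ t)) t := by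
  induction hf using Algebra.adjoin_induction with
  | mem f hf => obtain ⟨φ, rfl⟩ := hf; exact hγ φ
  | algebraMap r => exact differentiableAt_const r
  | add f g _ _ ihf ihg => exact ihf.add ihg
  | mul f g _ _ ihf ihg => exact ihf.mul ihg

/-- Nonvanishing loci are stable under intersection, by multiplying the polynomials, so they form a
basis and suffice for testing irreducibility. -/
theorem isZariskiIrreducible_of_mul {S : Set W} (hne : S.Nonempty)
    (h : ∀ f ∈ polyFun W, ∀ g ∈ polyFun W, (∃ x ∈ S, f x ≠ 0) → (∃ x ∈ S, g x ≠ 0) →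
      ∃ x ∈ S, f x * g x ≠ 0) : IsZariskiIrreducible S := by
  let := zariskiTopology W
  have hb : TopologicalSpace.IsTopologicalBasis
      (insert Set.univ {U : Set W | ∃ f ∈ polyFun W, U = {x | f x ≠ 0}}) := by
    refine TopologicalSpace.isTopologicalBasis_of_subbasis_of_inter rfl ?_
    rintro _ ⟨f, hf, rfl⟩ _ ⟨g, hg, rfl⟩
    exact ⟨f * g, mul_mem hf hg, by ext x; simp⟩
  have hb' : ∀ U ∈ insert Set.univ {U : Set W | ∃ f ∈ polyFun W, U = {x | f x ≠ 0}},
      ∃ f ∈ polyFun W, U = {x | f x ≠ 0} := by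
    rintro U (rfl | hU)
    · exact ⟨1, one_mem _, by simp⟩
    · exact hU
  refine ⟨hne, fun u v hu hv ⟨x, hxS, hxu⟩ ⟨y, hyS, hyv⟩ => ?_⟩
  obtain ⟨u', hu', hxu', hsu⟩ := hb.exists_subset_of_mem_open hxu hu
  obtain ⟨v', hv', hyv', hsv⟩ := hb.exists_subset_of_mem_open hyv hv
  obtain ⟨f, hf, rfl⟩ := hb' u' hu'
  obtain ⟨g, hg, rfl⟩ := hb' v' hv'
  obtain ⟨z, hzS, hz⟩ := h f hf g hg ⟨x, hxS, hxu'⟩ ⟨y, hyS, hyv'⟩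
  exact ⟨z, hzS, hsu (left_ne_zero_of_mul hz), hsv (right_ne_zero_of_mul hz)⟩

/-- A set any two points of which are joined by a holomorphic curve, parametrized by the
complement of a finite subset of `ℂ`, is irreducible. -/
theorem isZariskiIrreducible_of_curves {S : Set W} (hne : S.Nonempty)
    (h : ∀ x ∈ S, ∀ y ∈ S, ∃ γ : ℂ → W, ∃ s : Set ℂ, s.Finite ∧ 0 ∉ s ∧ 1 ∉ s ∧ γ 0 = x ∧
      γ 1 = y ∧ ∀ t ∉ s, γ t ∈ S ∧
        ∀ φ : Module.Dual ℂ W, DifferentiableAt ℂ (fun t => φ (γ t)) t) :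
    IsZariskiIrreducible S := by
  refine isZariskiIrreducible_of_mul hne ?_
  rintro f hf g hg ⟨x, hx, hfx⟩ ⟨y, hy, hgy⟩
  by_contra! hcon
  obtain ⟨γ, s, hs, h0, h1, rfl, rfl, hγ⟩ := h x hx y hy
  have ho : IsOpen sᶜ := hs.isClosed.isOpen_compl
  have hc : IsPreconnected sᶜ := (hs.countable.isConnected_compl_of_one_lt_rank
    (Complex.rank_real_complex ▸ Nat.one_lt_ofNat)).isPreconnected
  -- Along the curve, polynomial functions are analytic on a connected open set. If the product of
  -- two of them vanishes there, so does one of the factors, against its value at `0` or at `1`.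
  have han : ∀ f ∈ polyFun W, AnalyticOnNhd ℂ (fun t => f (γ t)) sᶜ := fun f hf =>
    DifferentiableOn.analyticOnNhd (fun t ht =>
      (polyFun_comp_differentiableAt (hγ t ht).2 hf).differentiableWithinAt) ho
  rcases (han f hf).eq_zero_or_eq_zero_of_mul_eq_zero (han g hg)
    (fun t ht => hcon _ (hγ t ht).1) hc with h' | h'
  · exact hfx (h' 0 h0)
  · exact hgy (h' 1 h1)

theorem IsZariskiComponent.eq_of_irreducible {S Z : Set W} (hS : IsZariskiIrreducible S)
    (hZ : IsZariskiComponent S Z) : Z = S :=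
  hZ.1.1.antisymm (hZ.2 ⟨subset_rfl, hS⟩ hZ.1.1)

/-- The velocity of a curve in `S` is a tangent vector. -/
theorem mem_zariskiTangent_of_curve {S : Set W} {γ : ℂ → W} {v : W}
    (hγ : ∀ φ : Module.Dual ℂ W, HasDerivAt (fun t => φ (γ t)) (φ v) 0)
    (hS : ∀ᶠ t in 𝓝 (0 : ℂ), γ t ∈ S) : v ∈ zariskiTangent S (γ 0) := by
  -- The chain rule, by induction on the polynomial: the derivative along the curve and the
  -- directional derivative are the same number. No norm on `W` is involved.
  have key : ∀ f ∈ polyFun W, ∃ d, HasDerivAt (fun t => f (γ t)) d 0 ∧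
      HasLineDerivAt ℂ f d (γ 0) v := by
    intro f hf
    induction hf using Algebra.adjoin_induction with
    | mem f hf =>
      obtain ⟨φ, rfl⟩ := hf
      refine ⟨φ v, hγ φ, ?_⟩
      simp only [HasLineDerivAt, map_add, map_smul, smul_eq_mul]
      simpa using ((hasDerivAt_id (0 : ℂ)).mul_const (φ v)).const_add (φ (γ 0))
    | algebraMap r =>
      exact ⟨0, hasDerivAt_const 0 r, by simpa [HasLineDerivAt] using hasDerivAt_const (0 : ℂ) r⟩
    | add f g _ _ ihf ihg =>
      obtain ⟨d, h1, h2⟩ := ihf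
      obtain ⟨d', h1', h2'⟩ := ihg
      exact ⟨d + d', h1.add h1', HasDerivAt.add h2 h2'⟩
    | mul f g _ _ ihf ihg =>
      obtain ⟨d, h1, h2⟩ := ihf
      obtain ⟨d', h1', h2'⟩ := ihg
      refine ⟨d * g (γ 0) + f (γ 0) * d', h1.mul h1', ?_⟩
      have h := HasDerivAt.mul h2 h2'
      simp only [zero_smul, add_zero] at h
      exact h
  intro f hf hfS
  obtain ⟨d, h1, h2⟩ := key f hf
  rw [h2.lineDeriv]
  refine h1.unique ((hasDerivAt_const (0 : ℂ) (0 : ℂ)).congr_of_eventuallyEq ?_)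
  filter_upwards [hS] with t ht using hfS _ ht

theorem coordRing_aeval_apply {S : Set W} {ι : Type*} (x : ι → coordRing S)
    (p : MvPolynomial ι ℂ) (s : S) :
    (MvPolynomial.aeval x p : coordRing S).1 s = MvPolynomial.eval (fun i => (x i).1 s) p := by
  have := MvPolynomial.map_aeval x
    (((Pi.evalAlgHom ℂ (fun _ : S => ℂ) s).comp (coordRing S).val).toRingHom) p
  simp only [AlgHom.toRingHom_eq_coe, RingHom.coe_coe, AlgHom.comp_apply, Pi.evalAlgHom_apply,
    Subalgebra.coe_val] at this
  rw [this, MvPolynomial.eval, MvPolynomial.coe_eval₂Hom, MvPolynomial.coe_eval₂Hom]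
  congr 1

/-- The dimension of `S` is at least that of any immersed manifold in `S`. -/
theorem finrank_le_trdeg_of_immersion [NormedAddCommGroup T] [NormedSpace ℂ T]
    [FiniteDimensional ℂ T] {S : Set W} {Θ : T → W} {L : T →ₗ[ℂ] W} {y : T}
    (hL : Function.Injective L)
    (hΘ : ∀ φ : Module.Dual ℂ W,
      HasStrictFDerivAt (fun t => φ (Θ t)) (φ ∘ₗ L).toContinuousLinearMap y)
    (hS : ∀ᶠ t in 𝓝 y, Θ t ∈ S) :
    (Module.finrank ℂ T : Cardinal) ≤ Algebra.trdeg ℂ (coordRing S) := by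
  -- The coordinates of a left inverse of `L` are `dim T` linear forms on `W`; their restrictions to
  -- `S` will be algebraically independent.
  obtain ⟨R, hR⟩ := L.exists_leftInverse_of_injective (LinearMap.ker_eq_bot.2 hL)
  set n := Module.finrank ℂ T
  set b := Module.finBasis ℂ T
  let x : Fin n → coordRing S := fun i =>
    ⟨fun s => (b.coord i ∘ₗ R) s, Algebra.subset_adjoin ⟨b.coord i ∘ₗ R, rfl⟩⟩
  have hx : AlgebraicIndependent ℂ x := by
    rw [algebraicIndependent_iff]
    intro p hp
    have hstrict : HasStrictFDerivAt (fun t => fun i => (b.coord i ∘ₗ R) (Θ t))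
        (b.equivFun.toContinuousLinearEquiv : T →L[ℂ] (Fin n → ℂ)) y := by
      rw [hasStrictFDerivAt_pi']
      intro i
      convert! hΘ (b.coord i ∘ₗ R) using 1
      ext v
      have := LinearMap.congr_fun hR v
      simp only [LinearMap.comp_apply, LinearMap.id_apply] at this
      simp [this]
    -- By the inverse function theorem these coordinates take all values in a ball of the sup norm,
    -- which is a product of discs. A polynomial vanishing on a product of infinite sets is zero.
    have hmap := hstrict.map_nhds_eq_of_equiv
    have hmem := image_mem_map (m := fun t => fun i => (b.coord i ∘ₗ R) (Θ t)) hS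
    rw [hmap, Metric.mem_nhds_iff] at hmem
    obtain ⟨ε, hε, hball⟩ := hmem
    rw [ball_pi _ hε] at hball
    refine MvPolynomial.funext_set (fun i => Metric.ball ((b.coord i ∘ₗ R) (Θ y)) ε)
      (fun i => infinite_of_mem_nhds _ (Metric.ball_mem_nhds _ hε)) ?_
    intro a ha
    obtain ⟨t, ht, rfl⟩ := hball ha
    rw [map_zero]
    have := coordRing_aeval_apply x p ⟨Θ t, ht⟩
    rw [hp] at this
    exact this.symm
  have := hx.lift_cardinalMk_le_trdeg
  simpa using this

theorem trdeg_polyFun_le [AddCommGroup T] [Module ℂ T] [FiniteDimensional ℂ T] :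
    Algebra.trdeg ℂ (polyFun T) ≤ Module.finrank ℂ T := by
  set b := Module.finBasis ℂ T
  have hsurj : Function.Surjective (MvPolynomial.aeval (R := ℂ)
      (fun i => (⟨fun t => b.coord i t, polyFun_of_dual _⟩ : polyFun T))) := by
    rintro ⟨f, hf⟩
    have hle : polyFun T ≤ ((polyFun T).val.comp (MvPolynomial.aeval (R := ℂ)
      (fun i => (⟨fun t => b.coord i t, polyFun_of_dual _⟩ : polyFun T)))).range := by
      refine Algebra.adjoin_le ?_
      rintro _ ⟨φ, rfl⟩
      have : (fun t => φ t) = ∑ i, φ (b i) • (fun t => b.coord i t) := by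
        ext t
        conv_lhs => rw [← b.sum_repr t, map_sum]
        simp [mul_comm]
      dsimp only
      rw [this]
      refine sum_mem fun i _ => Subalgebra.smul_mem _ ?_ _
      exact ⟨MvPolynomial.X i, by simp⟩
    obtain ⟨p, hp⟩ := hle hf
    exact ⟨p, Subtype.ext hp⟩
  have := lift_trdeg_le_of_surjective _ hsurj
  rw [MvPolynomial.trdeg_of_isDomain] at this
  simpa using this

/-- The image of `A` in `B × C` embeds in `B`, because `ker p ⊂ ker r`, and maps onto `C`;
transcendence degree is monotone under both kinds of map. -/
theorem trdeg_le_of_ker_le {R A B C : Type*} [CommRing R] [CommRing A] [CommRing B] [CommRing C]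
    [Algebra R A] [Algebra R B] [Algebra R C] (p : A →ₐ[R] B) (r : A →ₐ[R] C)
    (hr : Function.Surjective r) (h : ∀ a, p a = 0 → r a = 0) {n : ℕ}
    (hB : Algebra.trdeg R B ≤ n) : Algebra.trdeg R C ≤ n := by
  let D := (p.prod r).range
  have h1 : Function.Injective ((AlgHom.fst R B C).comp D.val) := by
    rw [injective_iff_map_eq_zero]
    rintro ⟨_, f, rfl⟩ h'
    exact Subtype.ext (Prod.ext h' (h f h'))
  have h2 : Function.Surjective ((AlgHom.snd R B C).comp D.val) := fun c => by
    obtain ⟨f, rfl⟩ := hr c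
    exact ⟨⟨_, ⟨f, rfl⟩⟩, rfl⟩
  have e4 := (lift_trdeg_le_of_injective _ h1).trans (Cardinal.lift_le.2 hB)
  rw [Cardinal.lift_natCast, Cardinal.lift_le_nat_iff] at e4
  have e5 := (lift_trdeg_le_of_surjective _ h2).trans (Cardinal.lift_le.2 e4)
  rwa [Cardinal.lift_natCast, Cardinal.lift_le_nat_iff] at e5

/-- The dimension of `Z` is at most that of a vector space from which there is a polynomial map
whose image has `Z` in its Zariski closure. -/
theorem trdeg_coordRing_le [AddCommGroup T] [Module ℂ T] [FiniteDimensional ℂ T] {Z : Set W}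
    {Ψ : T → W} (hΨ : ∀ φ : Module.Dual ℂ W, (fun t => φ (Ψ t)) ∈ polyFun T)
    (hZ : ∀ f ∈ polyFun W, (∀ t, f (Ψ t) = 0) → ∀ z ∈ Z, f z = 0) :
    Algebra.trdeg ℂ (coordRing Z) ≤ Module.finrank ℂ T := by
  have hres : ∀ f ∈ polyFun W, (fun z : Z => f z) ∈ coordRing Z := fun f hf =>
    polyFun_comp_mem (coordRing Z) (Ψ := Subtype.val)
      (fun φ => Algebra.subset_adjoin ⟨φ, rfl⟩) hf
  let pull : polyFun W →ₐ[ℂ] polyFun T :=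
    { toFun := fun f => ⟨fun t => f.1 (Ψ t), polyFun_comp_mem _ hΨ f.2⟩
      map_one' := rfl
      map_mul' := fun _ _ => rfl
      map_zero' := rfl
      map_add' := fun _ _ => rfl
      commutes' := fun _ => rfl }
  let res : polyFun W →ₐ[ℂ] coordRing Z :=
    { toFun := fun f => ⟨fun z => f.1 z, hres f.1 f.2⟩
      map_one' := rfl
      map_mul' := fun _ _ => rfl
      map_zero' := rfl
      map_add' := fun _ _ => rfl
      commutes' := fun _ => rfl }
  -- A polynomial killed by `pull` vanishes on the image of `Ψ`, hence on `Z`, so it is killed by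
  -- `res`.
  refine trdeg_le_of_ker_le pull res ?_ ?_ trdeg_polyFun_le
  · rintro ⟨g, hg⟩
    obtain ⟨f, hf, rfl⟩ : ∃ f ∈ polyFun W, (fun z : Z => f z) = g := by
      induction hg using Algebra.adjoin_induction with
      | mem f hf => obtain ⟨φ, rfl⟩ := hf; exact ⟨_, polyFun_of_dual φ, rfl⟩
      | algebraMap r => exact ⟨_, (polyFun W).algebraMap_mem r, rfl⟩
      | add f g _ _ ihf ihg =>
        obtain ⟨f', hf', rfl⟩ := ihf
        obtain ⟨g', hg', rfl⟩ := ihg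
        exact ⟨_, add_mem hf' hg', rfl⟩
      | mul f g _ _ ihf ihg =>
        obtain ⟨f', hf', rfl⟩ := ihf
        obtain ⟨g', hg', rfl⟩ := ihg
        exact ⟨_, mul_mem hf' hg', rfl⟩
    exact ⟨⟨f, hf⟩, rfl⟩
  · rintro ⟨f, hf⟩ h
    refine Subtype.ext (funext fun z => ?_)
    exact hZ f hf (fun t => congr_fun (congr_arg Subtype.val h) t) z z.2

/-- An irreducible `S` of half the dimension of `W` is Lagrangian if its tangent space at each
point contains an isotropic subspace of that dimension. -/
theorem isLagrangianVariety_of_isotropic [FiniteDimensional ℂ W] {S : Set W} {ω : W → W → ℂ}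
    {n : ℕ} (hS : IsZariskiIrreducible S) (hn : HasVarietyDim S n)
    (hW : 2 * n = Module.finrank ℂ W)
    (h : ∀ x ∈ S, ∃ E ≤ zariskiTangent S x, n ≤ Module.finrank ℂ E ∧
      ∀ v ∈ E, ∀ w ∈ E, ω v w = 0) : IsLagrangianVariety ω S := by
  refine ⟨?_, fun Z hZ => ⟨n, by rwa [hZ.eq_of_irreducible hS], hW⟩⟩
  rintro x ⟨Z, hZ, hx, hdim⟩
  obtain rfl := hZ.eq_of_irreducible hS
  obtain ⟨E, hE, hnE, hω⟩ := h x hx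
  -- At a smooth point the tangent space has dimension `n`, so the isotropic subspace `E` is all of
  -- it.
  have heq : n = Module.finrank ℂ (zariskiTangent Z x) :=
    Nat.cast_injective (R := Cardinal) (hn.symm.trans hdim)
  rw [← Submodule.eq_of_le_of_finrank_le hE (heq ▸ hnE)]
  exact hω

end AlgebraicGeometry

/-! ### Pairs of matrix families: conjugation, moment map and symplectic form. -/

section Pairs

variable {l : ℕ} {κ : Type*}

/-- Strictly upper triangular matrices. -/
def IsStrictUpper (m : Matrix (Fin l) (Fin l) ℂ) : Prop := ∀ i j, j ≤ i → m i j = 0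

theorem Matrix.IsUpperTriangular.mul_strict {c a : Matrix (Fin l) (Fin l) ℂ}
    (hc : c.IsUpperTriangular) (ha : IsStrictUpper a) : IsStrictUpper (c * a) := by
  intro i j hij
  rw [Matrix.mul_apply]
  refine Finset.sum_eq_zero fun k _ => ?_
  rcases lt_or_ge k i with h | h
  · rw [hc h, zero_mul]
  · rw [ha k j (hij.trans h), mul_zero]

theorem IsStrictUpper.mul_upper {c a : Matrix (Fin l) (Fin l) ℂ}
    (ha : IsStrictUpper a) (hc : c.IsUpperTriangular) : IsStrictUpper (a * c) := by
  intro i j hij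
  rw [Matrix.mul_apply]
  refine Finset.sum_eq_zero fun k _ => ?_
  rcases le_or_gt k i with h | h
  · rw [ha i k h, zero_mul]
  · rw [hc (show id j < id k from hij.trans_lt h), mul_zero]

theorem IsStrictUpper.trace_eq_zero {a : Matrix (Fin l) (Fin l) ℂ} (ha : IsStrictUpper a) :
    a.trace = 0 :=
  Finset.sum_eq_zero fun i _ => ha i i le_rfl

/-- Pairs of families of matrices. -/
abbrev PairSpace (κ : Type*) (l : ℕ) :=
  (κ → Matrix (Fin l) (Fin l) ℂ) × (κ → Matrix (Fin l) (Fin l) ℂ)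

/-- Simultaneous conjugation of all the matrices of a pair of families. -/
noncomputable def pairConj (P : Matrix (Fin l) (Fin l) ℂ) : PairSpace κ l →ₗ[ℂ] PairSpace κ l where
  toFun b := (fun k => P * b.1 k * P⁻¹, fun k => P * b.2 k * P⁻¹)
  map_add' b b' := by ext <;> simp [mul_add, add_mul]
  map_smul' c b := by ext <;> simp

/-- The infinitesimal action `b ↦ [X, b]`. -/
def pairLie (X : Matrix (Fin l) (Fin l) ℂ) (b : PairSpace κ l) : PairSpace κ l :=
  (fun k => X * b.1 k - b.1 k * X, fun k => X * b.2 k - b.2 k * X)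

theorem pairConj_mul (P R : Matrix (Fin l) (Fin l) ℂ) (b : PairSpace κ l) :
    pairConj (P * R) b = pairConj P (pairConj R b) := by
  simp [pairConj, Matrix.mul_inv_rev, mul_assoc]

theorem pairConj_one (b : PairSpace κ l) : pairConj 1 b = b := by
  simp [pairConj]

theorem pairConj_inv {P : Matrix (Fin l) (Fin l) ℂ} (hP : IsUnit P.det) (b : PairSpace κ l) :
    pairConj P⁻¹ (pairConj P b) = b := by
  rw [← pairConj_mul, Matrix.nonsing_inv_mul _ hP, pairConj_one]

variable [Fintype κ]

/-- The bilinear map whose restriction to the diagonal is the moment map. -/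
def pairBracket (b b' : PairSpace κ l) : Matrix (Fin l) (Fin l) ℂ :=
  ∑ k, (b.1 k * b'.2 k - b'.2 k * b.1 k)

/-- The symplectic form on pairs of families. -/
def pairForm (b b' : PairSpace κ l) : ℂ :=
  ∑ k, ((b.1 k * b'.2 k).trace - (b.2 k * b'.1 k).trace)

theorem pairForm_swap (b b' : PairSpace κ l) : pairForm b b' = -pairForm b' b := by
  rw [pairForm, pairForm, ← Finset.sum_neg_distrib]
  refine Finset.sum_congr rfl fun k _ => ?_
  rw [Matrix.trace_mul_comm (b.1 k), Matrix.trace_mul_comm (b.2 k)]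
  ring

theorem pairForm_add_left (b c d : PairSpace κ l) :
    pairForm (b + c) d = pairForm b d + pairForm c d := by
  rw [pairForm, pairForm, pairForm, ← Finset.sum_add_distrib]
  refine Finset.sum_congr rfl fun k _ => ?_
  simp [add_mul, Matrix.trace_add]
  ring

theorem pairForm_add_right (b c d : PairSpace κ l) :
    pairForm b (c + d) = pairForm b c + pairForm b d := by
  rw [pairForm_swap, pairForm_add_left, pairForm_swap c, pairForm_swap d]
  ring

theorem pairForm_conj {P : Matrix (Fin l) (Fin l) ℂ} (hP : IsUnit P.det) (b b' : PairSpace κ l) :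
    pairForm (pairConj P b) (pairConj P b') = pairForm b b' := by
  have key : ∀ x y : Matrix (Fin l) (Fin l) ℂ, (P * x * P⁻¹ * (P * y * P⁻¹)).trace =
      (x * y).trace := fun x y => by
    have : P * x * P⁻¹ * (P * y * P⁻¹) = P * (x * y) * P⁻¹ := by
      simp only [mul_assoc]
      rw [Matrix.nonsing_inv_mul_cancel_left _ _ hP]
    rw [this, Matrix.trace_mul_cycle, Matrix.nonsing_inv_mul _ hP, one_mul]
  simp [pairForm, pairConj, key]

theorem pairBracket_conj {P : Matrix (Fin l) (Fin l) ℂ} (hP : IsUnit P.det)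
    (b b' : PairSpace κ l) :
    pairBracket (pairConj P b) (pairConj P b') = P * pairBracket b b' * P⁻¹ := by
  have key : ∀ x y : Matrix (Fin l) (Fin l) ℂ, P * x * P⁻¹ * (P * y * P⁻¹) =
      P * (x * y) * P⁻¹ := fun x y => by
    simp only [mul_assoc]
    rw [Matrix.nonsing_inv_mul_cancel_left _ _ hP]
  simp [pairBracket, pairConj, key, Finset.mul_sum, Finset.sum_mul, mul_sub, sub_mul]

/-- The defining property of a moment map for conjugation: the right side is `Tr(X dμ_b(v))`. -/
theorem pairForm_lie (X : Matrix (Fin l) (Fin l) ℂ) (b v : PairSpace κ l) :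
    pairForm (pairLie X b) v = (X * (pairBracket v b + pairBracket b v)).trace := by
  rw [pairBracket, pairBracket, ← Finset.sum_add_distrib, Finset.mul_sum, Matrix.trace_sum,
    pairForm]
  refine Finset.sum_congr rfl fun k _ => ?_
  have key : ∀ c a : Matrix (Fin l) (Fin l) ℂ, (c * X * a).trace = (X * (a * c)).trace :=
    fun c a => by rw [mul_assoc, Matrix.trace_mul_comm, mul_assoc]
  simp only [pairLie, sub_mul, mul_add, mul_sub, Matrix.trace_sub, Matrix.trace_add, key,
    mul_assoc X]
  ring

/-- Infinitesimal equivariance of the moment map; on its zero fibre, orbit directions are therefore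
annihilated by its differential. -/
theorem pairBracket_lie (X : Matrix (Fin l) (Fin l) ℂ) (b : PairSpace κ l) :
    pairBracket (pairLie X b) b + pairBracket b (pairLie X b) =
      X * pairBracket b b - pairBracket b b * X := by
  simp only [pairBracket, Finset.mul_sum, Finset.sum_mul, ← Finset.sum_add_distrib,
    ← Finset.sum_sub_distrib]
  refine Finset.sum_congr rfl fun k _ => ?_
  simp only [pairLie]
  noncomm_ring

/-- The tangent vectors `[X, b] + β`, with `β` triangular and annihilated by the differential of
the moment map, form an isotropic family. -/
theorem pairForm_eq_zero {b : PairSpace κ l} (hb : pairBracket b b = 0)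
    {β β' : PairSpace κ l} (h1 : ∀ k, (β.1 k).IsUpperTriangular) (h2 : ∀ k, IsStrictUpper (β.2 k))
    (h1' : ∀ k, (β'.1 k).IsUpperTriangular) (h2' : ∀ k, IsStrictUpper (β'.2 k))
    (h : pairBracket β b + pairBracket b β = 0) (h' : pairBracket β' b + pairBracket b β' = 0)
    (X X' : Matrix (Fin l) (Fin l) ℂ) :
    pairForm (pairLie X b + β) (pairLie X' b + β') = 0 := by
  have e1 : pairForm (pairLie X b) (pairLie X' b) = 0 := by
    rw [pairForm_lie, pairBracket_lie, hb]; simp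
  have e2 : pairForm (pairLie X b) β' = 0 := by rw [pairForm_lie, h']; simp
  have e3 : pairForm β (pairLie X' b) = 0 := by rw [pairForm_swap, pairForm_lie, h]; simp
  have e4 : pairForm β β' = 0 := Finset.sum_eq_zero fun k _ => by
    rw [((h1 k).mul_strict (h2' k)).trace_eq_zero, ((h2 k).mul_upper (h1' k)).trace_eq_zero,
      sub_zero]
  rw [pairForm_add_left, pairForm_add_right, pairForm_add_right, e1, e2, e3, e4]
  simp

/-- Triangular pairs of families with vanishing moment map, such that the matrices of the first
family have distinct diagonal entries and the matrix at `k₀` is diagonal. -/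
structure IsNormalForm (k₀ : κ) (b : PairSpace κ l) : Prop where
  upper : ∀ k, (b.1 k).IsUpperTriangular
  strict : ∀ k, IsStrictUpper (b.2 k)
  diag : ∀ i j, i ≠ j → b.1 k₀ i j = 0
  moment : pairBracket b b = 0
  inj : ∀ k, Function.Injective fun i => b.1 k i i

variable (l) in
/-- The pairs of families that are conjugate to one in normal form. -/
def triangularLocus (k₀ : κ) : Set (PairSpace κ l) :=
  {x | ∃ P : Matrix (Fin l) (Fin l) ℂ, IsUnit P.det ∧ ∃ b, IsNormalForm k₀ b ∧ x = pairConj P b}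

end Pairs

/-! ### Parametrization of the normal forms. -/

section Parametrization

variable {l : ℕ} {κ : Type*}

/-- The upper triangular part of a matrix. -/
def upperPart : Matrix (Fin l) (Fin l) ℂ →ₗ[ℂ] Matrix (Fin l) (Fin l) ℂ where
  toFun m := Matrix.of fun i j => if i ≤ j then m i j else 0
  map_add' m m' := by ext i j; by_cases h : i ≤ j <;> simp [h]
  map_smul' c m := by ext i j; by_cases h : i ≤ j <;> simp [h]

/-- The transpose of the strictly lower triangular part of a matrix. -/
def lowerPart : Matrix (Fin l) (Fin l) ℂ →ₗ[ℂ] Matrix (Fin l) (Fin l) ℂ where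
  toFun m := Matrix.of fun i j => if i < j then m j i else 0
  map_add' m m' := by ext i j; by_cases h : i < j <;> simp [h]
  map_smul' c m := by ext i j; by_cases h : i < j <;> simp [h]

/-- The diagonal part of a matrix. -/
def diagPart : Matrix (Fin l) (Fin l) ℂ →ₗ[ℂ] Matrix (Fin l) (Fin l) ℂ where
  toFun m := Matrix.of fun i j => if i = j then m i j else 0
  map_add' m m' := by ext i j; by_cases h : i = j <;> simp [h]
  map_smul' c m := by ext i j; by_cases h : i = j <;> simp [h]

/-- The off-diagonal part of a matrix. -/
def offPart : Matrix (Fin l) (Fin l) ℂ →ₗ[ℂ] Matrix (Fin l) (Fin l) ℂ where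
  toFun m := Matrix.of fun i j => if i = j then 0 else m i j
  map_add' m m' := by ext i j; by_cases h : i = j <;> simp [h]
  map_smul' c m := by ext i j; by_cases h : i = j <;> simp [h]

theorem upperPart_apply (m : Matrix (Fin l) (Fin l) ℂ) (i j : Fin l) :
    upperPart m i j = if i ≤ j then m i j else 0 := rfl

theorem lowerPart_apply (m : Matrix (Fin l) (Fin l) ℂ) (i j : Fin l) :
    lowerPart m i j = if i < j then m j i else 0 := rfl

theorem diagPart_apply (m : Matrix (Fin l) (Fin l) ℂ) (i j : Fin l) :
    diagPart m i j = if i = j then m i j else 0 := rfl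

theorem offPart_apply (m : Matrix (Fin l) (Fin l) ℂ) (i j : Fin l) :
    offPart m i j = if i = j then 0 else m i j := rfl

theorem upperPart_upper (m : Matrix (Fin l) (Fin l) ℂ) : (upperPart m).IsUpperTriangular :=
  fun _ _ h => if_neg (not_le.2 h)

theorem lowerPart_strict (m : Matrix (Fin l) (Fin l) ℂ) : IsStrictUpper (lowerPart m) :=
  fun _ _ h => if_neg (not_lt.2 h)

theorem diagPart_upper (m : Matrix (Fin l) (Fin l) ℂ) : (diagPart m).IsUpperTriangular :=
  fun _ _ h => if_neg (ne_of_gt h)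

/-- Distinct diagonal entries make this factor nonzero off the diagonal. This solves the moment
equation for the matrix at `k₀`, and later makes the tangent map injective. -/
theorem diag_lie_apply {d : Matrix (Fin l) (Fin l) ℂ} (hd : ∀ i j, i ≠ j → d i j = 0)
    (a : Matrix (Fin l) (Fin l) ℂ) (i j : Fin l) :
    (d * a - a * d) i j = (d i i - d j j) * a i j := by
  rw [Matrix.sub_apply, Matrix.mul_apply, Matrix.mul_apply,
    Finset.sum_eq_single i (fun k _ h => by rw [hd i k h.symm, zero_mul]) (by simp),
    Finset.sum_eq_single j (fun k _ h => by rw [hd k j h, mul_zero]) (by simp)]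
  ring

variable [Fintype κ] [DecidableEq κ]

/-- The part of the moment map away from `k₀`. -/
def pairRest (k₀ : κ) (b : PairSpace κ l) : Matrix (Fin l) (Fin l) ℂ :=
  ∑ k ∈ Finset.univ.erase k₀, (b.1 k * b.2 k - b.2 k * b.1 k)

theorem pairBracket_self (k₀ : κ) (b : PairSpace κ l) :
    pairBracket b b = (b.1 k₀ * b.2 k₀ - b.2 k₀ * b.1 k₀) + pairRest k₀ b :=
  (Finset.add_sum_erase _ _ (Finset.mem_univ k₀)).symm

theorem pairRest_strict (k₀ : κ) {b : PairSpace κ l}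
    (h1 : ∀ k ≠ k₀, (b.1 k).IsUpperTriangular) (h2 : ∀ k ≠ k₀, IsStrictUpper (b.2 k)) :
    IsStrictUpper (pairRest k₀ b) := by
  intro i j hij
  rw [pairRest, Matrix.sum_apply]
  refine Finset.sum_eq_zero fun k hk => ?_
  have hk := Finset.ne_of_mem_erase hk
  rw [Matrix.sub_apply, (h1 k hk).mul_strict (h2 k hk) i j hij,
    (h2 k hk).mul_upper (h1 k hk) i j hij, sub_zero]

/-- The moment map vanishes if and only if the matrix at `k₀` of the second family has the
entries prescribed by the other matrices. -/
theorem pairBracket_eq_zero_iff {k₀ : κ} {b : PairSpace κ l}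
    (h1 : ∀ k, (b.1 k).IsUpperTriangular) (h2 : ∀ k, IsStrictUpper (b.2 k))
    (hd : ∀ i j, i ≠ j → b.1 k₀ i j = 0) :
    pairBracket b b = 0 ↔
      ∀ i j, i < j → (b.1 k₀ j j - b.1 k₀ i i) * b.2 k₀ i j = pairRest k₀ b i j := by
  have hS := pairRest_strict k₀ (fun k _ => h1 k) (fun k _ => h2 k)
  rw [pairBracket_self k₀]
  constructor
  · intro h i j _
    have := congr_fun (congr_fun h i) j
    rw [Matrix.add_apply, diag_lie_apply hd, Matrix.zero_apply] at this
    linear_combination -this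
  · intro h
    ext i j
    rw [Matrix.add_apply, diag_lie_apply hd, Matrix.zero_apply]
    rcases lt_or_ge i j with hij | hij
    · linear_combination -h i j hij
    · rw [h2 k₀ i j hij, hS i j hij]; ring

/-- The matrices in `M` encode the upper triangular first family and, below the diagonal, the
strictly upper triangular second family, for `k ≠ k₀`. -/
def pairFree (k₀ : κ) (M : κ → Matrix (Fin l) (Fin l) ℂ) : PairSpace κ l :=
  (fun k => if k = k₀ then diagPart (M k₀) else upperPart (M k),
    fun k => if k = k₀ then 0 else lowerPart (M k))

/-- The pair in normal form encoded by `M`. -/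
noncomputable def pairParam (k₀ : κ) (M : κ → Matrix (Fin l) (Fin l) ℂ) : PairSpace κ l :=
  (fun k => if k = k₀ then diagPart (M k₀) else upperPart (M k),
    -- These entries solve the moment equation. The off-diagonal entries of `M k₀` play no part
    -- here; they are reserved for the conjugating matrix.
    fun k => if k = k₀ then Matrix.of fun i j =>
      if i < j then pairRest k₀ (pairFree k₀ M) i j / (M k₀ j j - M k₀ i i) else 0
      else lowerPart (M k))

theorem pairRest_congr {k₀ : κ} {b b' : PairSpace κ l} (h1 : ∀ k ≠ k₀, b.1 k = b'.1 k)
    (h2 : ∀ k ≠ k₀, b.2 k = b'.2 k) : pairRest k₀ b = pairRest k₀ b' :=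
  Finset.sum_congr rfl fun k hk => by
    rw [h1 k (Finset.ne_of_mem_erase hk), h2 k (Finset.ne_of_mem_erase hk)]

theorem pairParam_normalForm {k₀ : κ} {M : κ → Matrix (Fin l) (Fin l) ℂ}
    (hM : ∀ k, Function.Injective fun i => M k i i) : IsNormalForm k₀ (pairParam k₀ M) := by
  have h1 : ∀ k, ((pairParam k₀ M).1 k).IsUpperTriangular := fun k => by
    by_cases h : k = k₀
    · simpa [pairParam, h] using diagPart_upper _
    · simpa [pairParam, h] using upperPart_upper _
  have h2 : ∀ k, IsStrictUpper ((pairParam k₀ M).2 k) := fun k => by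
    by_cases h : k = k₀
    · intro i j hij
      simp [pairParam, h, not_lt.2 hij]
    · simpa [pairParam, h] using lowerPart_strict _
  have hd : ∀ i j, i ≠ j → (pairParam k₀ M).1 k₀ i j = 0 := fun i j hij => by
    simp [pairParam, diagPart_apply, hij]
  refine ⟨h1, h2, hd, (pairBracket_eq_zero_iff h1 h2 hd).2 fun i j hij => ?_, fun k => ?_⟩
  · have hne : M k₀ j j - M k₀ i i ≠ 0 := sub_ne_zero.2 fun h => hij.ne' (hM k₀ h)
    rw [pairRest_congr (b' := pairFree k₀ M) (fun k hk => by simp [pairParam, pairFree])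
      (fun k hk => by simp [pairParam, pairFree, hk])]
    simp [pairParam, diagPart_apply, hij, mul_div_cancel₀ _ hne]
  · have : (fun i => (pairParam k₀ M).1 k i i) = fun i => M k i i := by
      ext i
      by_cases h : k = k₀ <;> simp [pairParam, h, diagPart_apply, upperPart_apply]
    rw [this]
    exact hM k

/-- The upper triangular `b.1 k` and the strictly lower triangular transpose of `b.2 k` occupy
complementary entries, so their sum encodes both. -/
theorem IsNormalForm.exists_param {k₀ : κ} {b : PairSpace κ l} (hb : IsNormalForm k₀ b) :
    ∃ M : κ → Matrix (Fin l) (Fin l) ℂ, (∀ k, Function.Injective fun i => M k i i) ∧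
      pairParam k₀ M = b := by
  have hup : ∀ k, upperPart (b.1 k + (b.2 k)ᵀ) = b.1 k := fun k => by
    ext i j
    rw [upperPart_apply]
    split_ifs with h
    · simp [hb.strict k j i h]
    · exact (hb.upper k (not_le.1 h)).symm
  have hlow : ∀ k, lowerPart (b.1 k + (b.2 k)ᵀ) = b.2 k := fun k => by
    ext i j
    rw [lowerPart_apply]
    split_ifs with h
    · simp [hb.upper k h]
    · exact (hb.strict k i j (not_lt.1 h)).symm
  have hM : ∀ k, (fun i => (b.1 k + (b.2 k)ᵀ) i i) = fun i => b.1 k i i := fun k => by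
    ext i
    simp [hb.strict k i i le_rfl]
  refine ⟨fun k => b.1 k + (b.2 k)ᵀ, fun k => (hM k).symm ▸ hb.inj k, ?_⟩
  have hrest : pairRest k₀ (pairFree k₀ fun k => b.1 k + (b.2 k)ᵀ) = pairRest k₀ b :=
    pairRest_congr (fun k hk => by simp [pairFree, hk, hup]) (fun k hk => by
      simp [pairFree, hk, hlow])
  refine Prod.ext (funext fun k => ?_) (funext fun k => ?_)
  · by_cases h : k = k₀
    · subst h
      ext i j
      by_cases hij : i = j
      · subst hij
        simpa [pairParam, diagPart_apply] using hb.strict k i i le_rfl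
      · simp [pairParam, diagPart_apply, hij, hb.diag i j hij]
    · simp only [pairParam, h, if_false, hup]
  · by_cases h : k = k₀
    · subst h
      ext i j
      simp only [pairParam, if_true, Matrix.of_apply, hrest]
      split_ifs with hij
      · have := (pairBracket_eq_zero_iff hb.upper hb.strict hb.diag).1 hb.moment i j hij
        have e : ∀ i, (b.1 k + (b.2 k)ᵀ) i i = b.1 k i i := fun i => congr_fun (hM k) i
        rw [e, e, ← this, mul_div_cancel_left₀]
        exact sub_ne_zero.2 fun h => hij.ne' (hb.inj k h)
      · exact (hb.strict k i j (not_lt.1 hij)).symm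
    · simp only [pairParam, h, if_false, hlow]

end Parametrization

/-! ### Differentiability of the parametrization and curves in the locus. -/

section Analysis

open scoped Matrix.Norms.Operator

variable {l : ℕ} {κ : Type*} [Fintype κ]
variable {E : Type*} [NormedAddCommGroup E] [NormedSpace ℂ E]

theorem contDiffAt_matrix {f : E → Matrix (Fin l) (Fin l) ℂ} {x : E}
    (h : ∀ i j, ContDiffAt ℂ 1 (fun y => f y i j) x) : ContDiffAt ℂ 1 f x := by
  have : f = fun y => ∑ i, ∑ j, f y i j • Matrix.single i j (1 : ℂ) := by
    ext1 y
    conv_lhs => rw [Matrix.matrix_eq_sum_single (f y)]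
    simp [Matrix.smul_single]
  rw [this]
  exact ContDiffAt.sum fun i _ => ContDiffAt.sum fun j _ => (h i j).smul contDiffAt_const

theorem contDiffAt_entry {f : E → Matrix (Fin l) (Fin l) ℂ} {x : E} (h : ContDiffAt ℂ 1 f x)
    (i j : Fin l) : ContDiffAt ℂ 1 (fun y => f y i j) x :=
  (LinearMap.toContinuousLinearMap (Matrix.entryLinearMap ℂ ℂ i j)).contDiff.contDiffAt.comp x h

theorem contDiffAt_linear (f : Matrix (Fin l) (Fin l) ℂ →ₗ[ℂ] Matrix (Fin l) (Fin l) ℂ) (k : κ)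
    (M : κ → Matrix (Fin l) (Fin l) ℂ) :
    ContDiffAt ℂ 1 (fun M : κ → Matrix (Fin l) (Fin l) ℂ => f (M k)) M :=
  (LinearMap.toContinuousLinearMap
    (f ∘ₗ (LinearMap.proj k : (κ → Matrix (Fin l) (Fin l) ℂ) →ₗ[ℂ] _))).contDiff.contDiffAt

theorem contDiffAt_pairParam [DecidableEq κ] (k₀ : κ) {M : κ → Matrix (Fin l) (Fin l) ℂ}
    (hM : Function.Injective fun i => M k₀ i i) : ContDiffAt ℂ 1 (pairParam k₀) M := by
  have hproj : ∀ k, ContDiffAt ℂ 1 (fun M : κ → Matrix (Fin l) (Fin l) ℂ => M k) M := fun k =>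
    contDiffAt_linear LinearMap.id k M
  have h1 : ∀ k, ContDiffAt ℂ 1 (fun M => (pairFree k₀ M : PairSpace κ l).1 k) M := fun k => by
    by_cases h : k = k₀
    · simpa only [pairFree, h, if_true] using contDiffAt_linear diagPart k₀ M
    · simpa only [pairFree, h, if_false] using contDiffAt_linear upperPart k M
  have h2 : ∀ k, ContDiffAt ℂ 1 (fun M => (pairFree k₀ M : PairSpace κ l).2 k) M := fun k => by
    by_cases h : k = k₀
    · simpa only [pairFree, h, if_true] using contDiffAt_const
    · simpa only [pairFree, h, if_false] using contDiffAt_linear lowerPart k M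
  refine (contDiffAt_pi.2 h1).prodMk (contDiffAt_pi.2 fun k => ?_)
  by_cases h : k = k₀
  · simp only [h, if_true]
    refine contDiffAt_matrix fun i j => ?_
    simp only [Matrix.of_apply]
    split_ifs with hij
    · refine ContDiffAt.div ?_ ?_ (sub_ne_zero.2 fun h => hij.ne' (hM h))
      · exact contDiffAt_entry (ContDiffAt.sum fun k _ =>
          ((h1 k).mul (h2 k)).sub ((h2 k).mul (h1 k))) i j
      · exact (contDiffAt_entry (hproj k₀) j j).sub (contDiffAt_entry (hproj k₀) i i)
    · exact contDiffAt_const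
  · simp only [h, if_false]
    exact contDiffAt_linear lowerPart k M

theorem eventually_injective_diag (M : κ → Matrix (Fin l) (Fin l) ℂ)
    (hM : ∀ k, Function.Injective fun i => M k i i) :
    ∀ᶠ M' in 𝓝 M, ∀ k, Function.Injective fun i => (M' k : Matrix (Fin l) (Fin l) ℂ) i i := by
  have hc : ∀ k i, Continuous fun M' : κ → Matrix (Fin l) (Fin l) ℂ => M' k i i := fun k i =>
    (continuous_apply k).matrix_elem i i
  have : ∀ᶠ M' in 𝓝 M, ∀ k i j, i ≠ j → (M' k : Matrix (Fin l) (Fin l) ℂ) i i ≠ M' k j j := by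
    simp only [eventually_all]
    exact fun k i j hij => ((hc k i).continuousAt.ne_iff_eventually_ne
      (hc k j).continuousAt).1 fun h => hij (hM k h)
  filter_upwards [this] with M' h k i j hij
  by_contra hne
  exact h k i j hne hij

/-- The determinant along a line is a polynomial in `t` with nonzero value at `0`. -/
theorem finite_det_eq_zero {P R : Matrix (Fin l) (Fin l) ℂ} (hP : IsUnit P.det) :
    {t : ℂ | (P + t • R).det = 0}.Finite := by
  let p : Polynomial ℂ := (P.map Polynomial.C + (Polynomial.X : Polynomial ℂ) •
    R.map Polynomial.C).det
  have hp : ∀ t, p.eval t = (P + t • R).det := fun t => by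
    rw [← Polynomial.coe_evalRingHom, RingHom.map_det]
    congr 1
    ext i j
    simpa using mul_comm _ _
  have hne : p ≠ 0 := fun h => hP.ne_zero (by simpa [h] using (hp 0).symm)
  refine (p.rootSet_finite ℂ).subset fun t ht => ?_
  rw [Polynomial.mem_rootSet]
  exact ⟨hne, by simpa [hp] using ht⟩

/-- For each pair `i ≠ j`, equality of the two entries is an affine equation in `t` that fails at `t
= 0`, so it has at most one solution. -/
theorem finite_not_injective_diag {M R : Matrix (Fin l) (Fin l) ℂ}
    (hM : Function.Injective fun i => M i i) :
    {t : ℂ | ¬ Function.Injective fun i => (M + t • R) i i}.Finite := by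
  have : {t : ℂ | ¬ Function.Injective fun i => (M + t • R) i i} ⊆
      ⋃ i : Fin l, ⋃ j : Fin l, {t | i ≠ j ∧ M i i - M j j + t * (R i i - R j j) = 0} := by
    intro t ht
    simp only [Set.mem_ofPred_eq, Function.Injective, not_forall] at ht
    obtain ⟨i, j, hij, hne⟩ := ht
    simp only [Set.mem_iUnion, Set.mem_ofPred_eq]
    refine ⟨i, j, hne, ?_⟩
    simp only [Matrix.add_apply, Matrix.smul_apply, smul_eq_mul] at hij
    linear_combination hij
  refine (Set.finite_iUnion fun i => Set.finite_iUnion fun j => ?_).subset this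
  by_cases hij : i = j
  · simp [hij]
  refine Set.Subsingleton.finite fun t ht s hs => ?_
  obtain ⟨-, ht⟩ := ht
  obtain ⟨-, hs⟩ := hs
  have hne : R i i - R j j ≠ 0 := fun h => by
    rw [h, mul_zero, add_zero, sub_eq_zero] at ht
    exact hij (hM ht)
  exact mul_right_cancel₀ hne (by linear_combination ht - hs)

theorem pairConj_differentiableAt {P : ℂ → Matrix (Fin l) (Fin l) ℂ} {b : ℂ → PairSpace κ l}
    {t : ℂ} (hP : DifferentiableAt ℂ P t) (hu : IsUnit (P t).det) (hb : DifferentiableAt ℂ b t) :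
    DifferentiableAt ℂ (fun t => pairConj (P t) (b t)) t := by
  have hinv : DifferentiableAt ℂ (fun t => (P t)⁻¹) t := by
    simp only [Matrix.nonsing_inv_eq_ringInverse]
    exact hP.inverse ((Matrix.isUnit_iff_isUnit_det _).2 hu)
  refine DifferentiableAt.prodMk (differentiableAt_pi.2 fun k => ?_)
    (differentiableAt_pi.2 fun k => ?_)
  · exact (hP.mul (differentiableAt_pi.1 hb.fst k)).mul hinv
  · exact (hP.mul (differentiableAt_pi.1 hb.snd k)).mul hinv

/-- Both the conjugating matrix and the parameters move along straight lines. The excluded times are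
those at which the former becomes singular or two diagonal entries collide. -/
theorem triangularLocus_curves [DecidableEq κ] (k₀ : κ) :
    ∀ x ∈ triangularLocus l k₀, ∀ y ∈ triangularLocus l k₀,
    ∃ γ : ℂ → PairSpace κ l, ∃ s : Set ℂ, s.Finite ∧ 0 ∉ s ∧ 1 ∉ s ∧ γ 0 = x ∧ γ 1 = y ∧
      ∀ t ∉ s, γ t ∈ triangularLocus l k₀ ∧ DifferentiableAt ℂ γ t := by
  rintro x ⟨P, hP, b, hb, rfl⟩ y ⟨P', hP', b', hb', rfl⟩
  obtain ⟨M, hM, rfl⟩ := hb.exists_param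
  obtain ⟨M', hM', rfl⟩ := hb'.exists_param
  refine ⟨fun t => pairConj (P + t • (P' - P)) (pairParam k₀ (M + t • (M' - M))),
    {t | (P + t • (P' - P)).det = 0} ∪
      ⋃ k, {t | ¬ Function.Injective fun i => (M k + t • (M' k - M k)) i i},
    (finite_det_eq_zero hP).union (Set.finite_iUnion fun k => finite_not_injective_diag (hM k)),
    ?_, ?_, ?_, ?_, fun t ht => ?_⟩
  · simpa [hP.ne_zero] using hM
  · simpa [hP'.ne_zero] using hM'
  · simp
  · simp
  · simp only [Set.mem_union, Set.mem_ofPred_eq, Set.mem_iUnion, not_or, not_exists, not_not] at ht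
    have hu : IsUnit (P + t • (P' - P)).det := isUnit_iff_ne_zero.2 ht.1
    refine ⟨⟨_, hu, _, pairParam_normalForm ht.2, rfl⟩, ?_⟩
    refine pairConj_differentiableAt ?_ hu ?_
    · exact (differentiableAt_id.smul_const _).const_add P
    · have h1 : DifferentiableAt ℂ (fun t : ℂ => M + t • (M' - M)) t :=
        (differentiableAt_id.smul_const _).const_add M
      have h2 : DifferentiableAt ℂ (pairParam k₀) (M + t • (M' - M)) :=
        (contDiffAt_pairParam k₀ (ht.2 k₀)).differentiableAt one_ne_zero
      exact h2.comp t h1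

end Analysis

/-! ### The immersion and its isotropic tangent spaces. -/

section Immersion

open scoped Matrix.Norms.Operator

variable {l : ℕ} {κ : Type*} [Fintype κ]

/-- Reads off those components of a derivative in which the map is already linear, without computing
the derivative. -/
theorem HasFDerivAt.apply_of_linear {T E F : Type*} [NormedAddCommGroup T] [NormedSpace ℂ T]
    [FiniteDimensional ℂ T] [NormedAddCommGroup E] [NormedSpace ℂ E] [FiniteDimensional ℂ E]
    [NormedAddCommGroup F] [NormedSpace ℂ F] {G : T → E} {G' : T →L[ℂ] E} {x : T}
    (hG : HasFDerivAt G G' x) (f : E →ₗ[ℂ] F) (f' : T →ₗ[ℂ] F) (h : ∀ y, f (G y) = f' y) (y : T) :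
    f (G' y) = f' y := by
  have h1 := (LinearMap.toContinuousLinearMap f).hasFDerivAt.comp x hG
  have h2 : HasFDerivAt (fun y => f (G y)) (LinearMap.toContinuousLinearMap f') x :=
    (LinearMap.toContinuousLinearMap f').hasFDerivAt.congr_of_eventuallyEq (.of_forall h)
  exact congr_arg (fun g : T →L[ℂ] F => g y) (h1.unique h2)

/-- Differentiating a vanishing moment map. -/
theorem pairBracket_deriv {b : ℂ → PairSpace κ l} {β : PairSpace κ l} (hb : HasDerivAt b β 0)
    (h0 : ∀ᶠ t in 𝓝 0, pairBracket (b t) (b t) = 0) :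
    pairBracket β (b 0) + pairBracket (b 0) β = 0 := by
  have h1 : ∀ k, HasDerivAt (fun t => (b t).1 k) (β.1 k) 0 := hasDerivAt_pi.1 hb.fst
  have h2 : ∀ k, HasDerivAt (fun t => (b t).2 k) (β.2 k) 0 := hasDerivAt_pi.1 hb.snd
  have h := HasDerivAt.fun_sum (u := Finset.univ) fun k _ =>
    ((h1 k).fun_mul (h2 k)).fun_sub ((h2 k).fun_mul (h1 k))
  have h' := h.unique
    ((hasDerivAt_const (0 : ℂ) (0 : Matrix (Fin l) (Fin l) ℂ)).congr_of_eventuallyEq h0)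
  rw [← h', pairBracket, pairBracket, ← Finset.sum_add_distrib]
  refine Finset.sum_congr rfl fun k _ => ?_
  abel

/-- Inversion has derivative `-1` at the identity, so the product rule yields the commutator with
`X` plus the derivative of `c`. -/
theorem hasStrictFDerivAt_mul_mul_inverse {T A : Type*} [NormedAddCommGroup T] [NormedSpace ℂ T]
    [NormedRing A] [NormedAlgebra ℂ A] [HasSummableGeomSeries A] (p q : A) {X C : T →L[ℂ] A}
    {c : T → A} (hc : HasStrictFDerivAt c C 0) {D : T →L[ℂ] A}
    (hD : ∀ y, D y = p * (X y * c 0 - c 0 * X y + C y) * q) :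
    HasStrictFDerivAt (fun y => p * (1 + X y) * c y * (Ring.inverse (1 + X y) * q)) D 0 := by
  have hX : HasStrictFDerivAt (fun y => 1 + X y) X 0 := X.hasStrictFDerivAt.const_add 1
  have hinv : HasStrictFDerivAt (fun y => Ring.inverse (1 + X y)) (-X) 0 := by
    have h1 : HasStrictFDerivAt Ring.inverse (-ContinuousLinearMap.mulLeftRight ℂ A
        ↑(1 : Aˣ)⁻¹ ↑(1 : Aˣ)⁻¹) (1 + X 0) := by
      simpa using hasStrictFDerivAt_ringInverse (𝕜 := ℂ) (1 : Aˣ)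
    convert! h1.comp 0 hX using 1
    ext1 y
    simp
  have h := ((hX.const_mul p).mul' hc).mul' (hinv.mul_const' q)
  convert! h using 1
  ext1 y
  simp [hD, mul_add, add_mul, mul_sub, sub_mul, mul_assoc]
  abel

theorem hasStrictFDerivAt_conj_mul {T : Type*} [NormedAddCommGroup T] [NormedSpace ℂ T]
    (P : Matrix (Fin l) (Fin l) ℂ) {X C : T →L[ℂ] Matrix (Fin l) (Fin l) ℂ}
    {c : T → Matrix (Fin l) (Fin l) ℂ} (hc : HasStrictFDerivAt c C 0)
    {D : T →L[ℂ] Matrix (Fin l) (Fin l) ℂ}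
    (hD : ∀ y, D y = P * (X y * c 0 - c 0 * X y + C y) * P⁻¹) :
    HasStrictFDerivAt (fun y => P * (1 + X y) * c y * (P * (1 + X y))⁻¹) D 0 := by
  have h := hasStrictFDerivAt_mul_mul_inverse P P⁻¹ hc hD
  simp only [← Matrix.nonsing_inv_eq_ringInverse, ← Matrix.mul_inv_rev] at h
  exact h

variable [DecidableEq κ]

/-- The tangent vectors of the parametrization of the triangular locus. -/
noncomputable def pairTangent (k₀ : κ) (P : Matrix (Fin l) (Fin l) ℂ) (b : PairSpace κ l)
    (G' : (κ → Matrix (Fin l) (Fin l) ℂ) →ₗ[ℂ] PairSpace κ l) :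
    (κ → Matrix (Fin l) (Fin l) ℂ) →ₗ[ℂ] PairSpace κ l :=
  pairConj P ∘ₗ
    { toFun := fun Y => pairLie (offPart (Y k₀)) b + G' Y
      map_add' := fun Y Y' => by ext <;> simp [pairLie, add_mul, mul_add] <;> abel
      map_smul' := fun c Y => by ext <;> simp [pairLie, mul_sub] }

/-- Near each of its points, the triangular locus contains an immersed submanifold with isotropic
tangent space of half the dimension. -/
theorem triangularLocus_immersion (k₀ : κ) {x : PairSpace κ l} (hx : x ∈ triangularLocus l k₀) :
    ∃ (Θ : (κ → Matrix (Fin l) (Fin l) ℂ) → PairSpace κ l)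
      (D : (κ → Matrix (Fin l) (Fin l) ℂ) →ₗ[ℂ] PairSpace κ l),
      Function.Injective D ∧ HasStrictFDerivAt Θ D.toContinuousLinearMap 0 ∧ Θ 0 = x ∧
      (∀ᶠ Y in 𝓝 0, Θ Y ∈ triangularLocus l k₀) ∧ ∀ Y Y', pairForm (D Y) (D Y') = 0 := by
  obtain ⟨P, hP, b, hb, rfl⟩ := hx
  obtain ⟨M, hM, rfl⟩ := hb.exists_param
  set b := pairParam k₀ M with hbdef
  -- The derivative is kept abstract. Of its component at `k₀` in the second family, which involves
  -- quotients, only strict triangularity and the linearized moment equation are needed.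
  obtain ⟨G', hG⟩ : ∃ G', HasStrictFDerivAt (pairParam k₀) G' M :=
    ⟨_, (contDiffAt_pairParam k₀ (hM k₀)).hasStrictFDerivAt one_ne_zero⟩
  have hG1 : ∀ k ≠ k₀, ∀ Y, (G' Y).1 k = upperPart (Y k) := fun k hk Y =>
    hG.hasFDerivAt.apply_of_linear (LinearMap.proj k ∘ₗ LinearMap.fst ℂ _ _)
      (upperPart ∘ₗ LinearMap.proj k) (fun M' => by simp [pairParam, hk]) Y
  have hG1' : ∀ Y, (G' Y).1 k₀ = diagPart (Y k₀) := fun Y =>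
    hG.hasFDerivAt.apply_of_linear (LinearMap.proj k₀ ∘ₗ LinearMap.fst ℂ _ _)
      (diagPart ∘ₗ LinearMap.proj k₀) (fun M' => by simp [pairParam]) Y
  have hG2 : ∀ k ≠ k₀, ∀ Y, (G' Y).2 k = lowerPart (Y k) := fun k hk Y =>
    hG.hasFDerivAt.apply_of_linear (LinearMap.proj k ∘ₗ LinearMap.snd ℂ _ _)
      (lowerPart ∘ₗ LinearMap.proj k) (fun M' => by simp [pairParam, hk]) Y
  have hG2' : ∀ Y, IsStrictUpper ((G' Y).2 k₀) := fun Y i j hij =>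
    hG.hasFDerivAt.apply_of_linear
      (Matrix.entryLinearMap ℂ ℂ i j ∘ₗ (LinearMap.proj k₀ :
        (κ → Matrix (Fin l) (Fin l) ℂ) →ₗ[ℂ] _) ∘ₗ LinearMap.snd ℂ _ _)
      0 (fun M' => by simp [pairParam, not_lt.2 hij]) Y
  have hup : ∀ Y k, ((G' Y).1 k).IsUpperTriangular := fun Y k => by
    by_cases hk : k = k₀
    · rw [hk, hG1']; exact diagPart_upper _
    · rw [hG1 k hk]; exact upperPart_upper _
  have hst : ∀ Y k, IsStrictUpper ((G' Y).2 k) := fun Y k => by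
    by_cases hk : k = k₀
    · rw [hk]; exact hG2' Y
    · rw [hG2 k hk]; exact lowerPart_strict _
  -- The parametrization stays in the zero fibre of the moment map near `M`, so its velocities are
  -- annihilated by the differential.
  have hmom : ∀ Y, pairBracket (G' Y) b + pairBracket b (G' Y) = 0 := fun Y => by
    have hline : HasDerivAt (fun t : ℂ => M + t • Y) Y 0 := by
      have h := ((hasDerivAt_id (0 : ℂ)).smul_const Y).const_add M
      rwa [one_smul] at h
    have h1 : HasFDerivAt (pairParam k₀) G' (M + (0 : ℂ) • Y) := by simpa using hG.hasFDerivAt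
    have h2 := h1.comp_hasDerivAt (0 : ℂ) hline
    have h3 := pairBracket_deriv h2 ?_
    · rw [Function.comp_apply, zero_smul, add_zero] at h3
      exact h3
    · have h4 : Tendsto (fun t : ℂ => M + t • Y) (𝓝 0) (𝓝 M) := by
        have h := hline.continuousAt.tendsto
        rwa [zero_smul, add_zero] at h
      filter_upwards [h4.eventually (eventually_injective_diag M hM)] with t ht
      exact (pairParam_normalForm ht).moment
  -- The off-diagonal entries of `Y k₀` move the conjugating matrix transversally to the diagonal
  -- torus; all other entries move the normal form.
  refine ⟨fun Y => pairConj (P * (1 + offPart (Y k₀))) (pairParam k₀ (M + Y)),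
    pairTangent k₀ P b G', ?_, ?_, ?_, ?_, ?_⟩
  · rw [injective_iff_map_eq_zero]
    intro Y hY
    have h0 : pairLie (offPart (Y k₀)) b + G' Y = 0 := by
      rw [← pairConj_inv hP (pairLie (offPart (Y k₀)) b + G' Y)]
      exact (congr_arg (pairConj P⁻¹) hY).trans (map_zero _)
    -- In the first family at `k₀`, the derivative of the normal form is diagonal, so the
    -- off-diagonal entries come from the commutator with `b.1 k₀` alone.
    have hoff : offPart (Y k₀) = 0 := by
      ext i j
      by_cases hij : i = j
      · simp [offPart_apply, hij]
      have h := congr_fun (congr_fun (congr_fun (congr_arg Prod.fst h0) k₀) i) j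
      have h' : (b.1 k₀ * offPart (Y k₀) - offPart (Y k₀) * b.1 k₀) i j = 0 := by
        simp only [Prod.fst_add, Pi.add_apply, Matrix.add_apply, hG1', diagPart_apply, hij,
          if_false, add_zero] at h
        rw [← neg_sub, Matrix.neg_apply, neg_eq_zero]
        exact h
      rw [diag_lie_apply hb.diag] at h'
      exact (mul_eq_zero.1 h').resolve_left (sub_ne_zero.2 fun h => hij (hb.inj k₀ h))
    have hG0 : G' Y = 0 := by
      rw [← h0, hoff]
      ext <;> simp [pairLie]
    ext k i j
    by_cases hk : k = k₀
    · subst hk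
      by_cases hij : i = j
      · have := hG1' Y
        rw [hG0] at this
        have := congr_fun (congr_fun this i) j
        simpa [diagPart_apply, hij] using this.symm
      · simpa [offPart_apply, hij] using congr_fun (congr_fun hoff i) j
    · rcases le_or_gt i j with hij | hij
      · have := hG1 k hk Y
        rw [hG0] at this
        have := congr_fun (congr_fun this i) j
        simpa [upperPart_apply, hij] using this.symm
      · have := hG2 k hk Y
        rw [hG0] at this
        have := congr_fun (congr_fun this j) i
        simpa [lowerPart_apply, hij] using this.symm
  · let X : (κ → Matrix (Fin l) (Fin l) ℂ) →L[ℂ] Matrix (Fin l) (Fin l) ℂ :=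
      LinearMap.toContinuousLinearMap (offPart ∘ₗ LinearMap.proj k₀)
    have hGM : HasStrictFDerivAt (fun Y => pairParam k₀ (M + Y)) G' 0 := by
      have h1 : HasStrictFDerivAt (pairParam k₀) G' (M + 0) := by simpa using hG
      simpa using! h1.comp 0 ((hasStrictFDerivAt_id 0).const_add M)
    refine HasStrictFDerivAt.prodMk (f₁' := ContinuousLinearMap.fst ℂ _ _ ∘L
      (pairTangent k₀ P b G').toContinuousLinearMap) (f₂' := ContinuousLinearMap.snd ℂ _ _ ∘L
      (pairTangent k₀ P b G').toContinuousLinearMap) ?_ ?_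
    · refine hasStrictFDerivAt_pi'.2 fun k => ?_
      exact hasStrictFDerivAt_conj_mul P (X := X) (hasStrictFDerivAt_pi'.1 hGM.fst k)
        (fun y => by rw [add_zero]; rfl)
    · refine hasStrictFDerivAt_pi'.2 fun k => ?_
      exact hasStrictFDerivAt_conj_mul P (X := X) (hasStrictFDerivAt_pi'.1 hGM.snd k)
        (fun y => by rw [add_zero]; rfl)
  · simp [hbdef]
  · have h1 : Tendsto (fun Y => M + Y) (𝓝 0) (𝓝 M) := by
      simpa using (continuous_const_add M).tendsto 0
    have h2 : Continuous fun Y : κ → Matrix (Fin l) (Fin l) ℂ =>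
        (P * (1 + offPart (Y k₀))).det := by
      refine Continuous.matrix_det (continuous_const.mul (continuous_const.add ?_))
      exact (LinearMap.toContinuousLinearMap
        (offPart ∘ₗ (LinearMap.proj k₀ : (κ → Matrix (Fin l) (Fin l) ℂ) →ₗ[ℂ] _))).continuous
    have h3 : ∀ᶠ Y in 𝓝 (0 : κ → Matrix (Fin l) (Fin l) ℂ),
        (P * (1 + offPart (Y k₀))).det ≠ 0 :=
      h2.continuousAt.eventually_ne (by simpa using hP.ne_zero)
    filter_upwards [h1.eventually (eventually_injective_diag M hM), h3] with Y hY hY'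
    exact ⟨_, isUnit_iff_ne_zero.2 hY', _, pairParam_normalForm hY, rfl⟩
  · intro Y Y'
    exact (pairForm_conj hP _ _).trans (pairForm_eq_zero hb.moment (hup Y) (hst Y) (hup Y') (hst Y')
      (hmom Y) (hmom Y') _ _)

end Immersion

/-! ### A polynomial map with dense image, for the upper bound on the dimension. -/

section Polynomial

variable {l : ℕ} {κ : Type*} {T : Type*} (A : Subalgebra ℂ (T → ℂ))

/-- The entries of the matrix valued function `f` lie in the algebra of functions `A`. -/
def EntriesIn (f : T → Matrix (Fin l) (Fin l) ℂ) : Prop := ∀ i j, (fun t => f t i j) ∈ A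

variable {A}

theorem EntriesIn.mul {f g : T → Matrix (Fin l) (Fin l) ℂ} (hf : EntriesIn A f)
    (hg : EntriesIn A g) : EntriesIn A fun t => f t * g t := fun i j => by
  have : (fun t => (f t * g t) i j) = ∑ k, (fun t => f t i k) * fun t => g t k j := by
    ext t
    simp [Matrix.mul_apply]
  rw [this]
  exact sum_mem fun k _ => mul_mem (hf i k) (hg k j)

theorem EntriesIn.sub {f g : T → Matrix (Fin l) (Fin l) ℂ} (hf : EntriesIn A f)
    (hg : EntriesIn A g) : EntriesIn A fun t => f t - g t := fun i j => sub_mem (hf i j) (hg i j)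

theorem EntriesIn.add {f g : T → Matrix (Fin l) (Fin l) ℂ} (hf : EntriesIn A f)
    (hg : EntriesIn A g) : EntriesIn A fun t => f t + g t := fun i j => add_mem (hf i j) (hg i j)

theorem EntriesIn.const (m : Matrix (Fin l) (Fin l) ℂ) : EntriesIn A fun _ => m :=
  fun i j => A.algebraMap_mem (m i j)

theorem EntriesIn.sum {ι : Type*} {s : Finset ι} {f : ι → T → Matrix (Fin l) (Fin l) ℂ}
    (hf : ∀ k ∈ s, EntriesIn A (f k)) : EntriesIn A fun t => ∑ k ∈ s, f k t := fun i j => by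
  have : (fun t => (∑ k ∈ s, f k t) i j) = ∑ k ∈ s, fun t => f k t i j := by
    ext t
    simp [Matrix.sum_apply]
  rw [this]
  exact sum_mem fun k hk => hf k hk i j

theorem EntriesIn.smul {c : T → ℂ} {f : T → Matrix (Fin l) (Fin l) ℂ} (hc : c ∈ A)
    (hf : EntriesIn A f) : EntriesIn A fun t => c t • f t := fun i j => mul_mem hc (hf i j)

theorem EntriesIn.det {f : T → Matrix (Fin l) (Fin l) ℂ} (hf : EntriesIn A f) :
    (fun t => (f t).det) ∈ A := by
  have : (fun t => (f t).det) =
      ∑ σ : Equiv.Perm (Fin l), ((Equiv.Perm.sign σ : ℤ) : ℂ) • ∏ i, fun t => f t (σ i) i := by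
    ext t
    simp [Matrix.det_apply']
  rw [this]
  exact sum_mem fun σ _ => A.smul_mem (prod_mem fun i _ => hf _ _) _

theorem EntriesIn.adjugate {f : T → Matrix (Fin l) (Fin l) ℂ} (hf : EntriesIn A f) :
    EntriesIn A fun t => (f t).adjugate := fun i j => by
  simp only [Matrix.adjugate_apply]
  refine EntriesIn.det (f := fun t => (f t).updateRow j (Pi.single i 1)) fun a b => ?_
  by_cases h : a = j
  · subst h
    simp only [Matrix.updateRow_self]
    exact A.algebraMap_mem ((Pi.single i (1 : ℂ) : Fin l → ℂ) b)
  · simpa [Matrix.updateRow_ne h] using hf a b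

theorem pairSpace_dual_comp_mem [Fintype κ] {Ψ : T → PairSpace κ l}
    (h1 : ∀ k, EntriesIn A fun t => (Ψ t).1 k) (h2 : ∀ k, EntriesIn A fun t => (Ψ t).2 k)
    (φ : Module.Dual ℂ (PairSpace κ l)) : (fun t => φ (Ψ t)) ∈ A := by
  classical
  have key : ∀ (F : (κ → Matrix (Fin l) (Fin l) ℂ) →ₗ[ℂ] ℂ) (g : T → κ → Matrix (Fin l) (Fin l) ℂ),
      (∀ k, EntriesIn A fun t => g t k) → (fun t => F (g t)) ∈ A := fun F g hg => by
    have : (fun t => F (g t)) = ∑ k, ∑ i, ∑ j,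
        F (Pi.single k (Matrix.single i j 1)) • fun t => g t k i j := by
      ext t
      conv_lhs => rw [← Finset.univ_sum_single (g t), map_sum]
      simp only [Finset.sum_apply, Pi.smul_apply, smul_eq_mul]
      refine Finset.sum_congr rfl fun k _ => ?_
      have e := congr_arg (F ∘ₗ LinearMap.single ℂ (fun _ : κ => Matrix (Fin l) (Fin l) ℂ) k)
        (Matrix.matrix_eq_sum_single (g t k))
      simp only [map_sum, LinearMap.comp_apply, LinearMap.coe_single] at e
      rw [e]
      refine Finset.sum_congr rfl fun i _ => Finset.sum_congr rfl fun j _ => ?_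
      have : Matrix.single i j (g t k i j) = g t k i j • Matrix.single i j (1 : ℂ) := by
        simp [Matrix.smul_single]
      rw [this, Pi.single_smul, map_smul, smul_eq_mul, mul_comm]
    rw [this]
    exact sum_mem fun k _ => sum_mem fun i _ => sum_mem fun j _ => A.smul_mem (hg k i j) _
  have : (fun t => φ (Ψ t)) = (fun t => (φ ∘ₗ LinearMap.inl ℂ _ _) (Ψ t).1) +
      fun t => (φ ∘ₗ LinearMap.inr ℂ _ _) (Ψ t).2 := by
    ext t
    simp [← map_add]
  rw [this]
  exact add_mem (key _ _ h1) (key _ _ h2)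

theorem entriesIn_linear (f : Matrix (Fin l) (Fin l) ℂ →ₗ[ℂ] Matrix (Fin l) (Fin l) ℂ) (k : κ) :
    EntriesIn (polyFun (κ → Matrix (Fin l) (Fin l) ℂ)) fun M => f (M k) := fun i j =>
  polyFun_of_dual (Matrix.entryLinearMap ℂ ℂ i j ∘ₗ f ∘ₗ
    (LinearMap.proj k : (κ → Matrix (Fin l) (Fin l) ℂ) →ₗ[ℂ] _))

variable [Fintype κ]

/-- The torus preserves normal forms, so a conjugating matrix with nonzero diagonal entries can be
rescaled to have unit diagonal. -/
theorem IsNormalForm.conj_diagonal {k₀ : κ} {b : PairSpace κ l} (hb : IsNormalForm k₀ b)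
    {d : Fin l → ℂ} (hd : ∀ i, d i ≠ 0) : IsNormalForm k₀ (pairConj (Matrix.diagonal d) b) := by
  have hinv : (Matrix.diagonal d)⁻¹ = Matrix.diagonal fun i => (d i)⁻¹ := by
    refine Matrix.inv_eq_right_inv ?_
    simp [Matrix.diagonal_mul_diagonal, hd]
  have hu : IsUnit (Matrix.diagonal d).det := by
    simp [Matrix.det_diagonal, Finset.prod_ne_zero_iff, hd]
  have h1 : ∀ k i j, (pairConj (Matrix.diagonal d) b).1 k i j = d i * b.1 k i j * (d j)⁻¹ :=
    fun k i j => by simp [pairConj, hinv]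
  have h2 : ∀ k i j, (pairConj (Matrix.diagonal d) b).2 k i j = d i * b.2 k i j * (d j)⁻¹ :=
    fun k i j => by simp [pairConj, hinv]
  refine ⟨fun k i j h => ?_, fun k i j h => ?_, fun i j h => ?_, ?_, fun k => ?_⟩
  · rw [h1, hb.upper k h]; simp
  · rw [h2, hb.strict k i j h]; simp
  · rw [h1, hb.diag i j h]; simp
  · rw [pairBracket_conj hu, hb.moment]; simp
  · have : (fun i => (pairConj (Matrix.diagonal d) b).1 k i i) = fun i => b.1 k i i := by
      ext i
      rw [h1, mul_right_comm, mul_inv_cancel₀ (hd i), one_mul]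
    rw [this]
    exact hb.inj k

variable [DecidableEq κ]

/-- The differences of the diagonal entries of a matrix. -/
def diagDiff (m : Matrix (Fin l) (Fin l) ℂ) (p : Fin l × Fin l) : ℂ := m p.2 p.2 - m p.1 p.1

variable (l) in
/-- The pairs of indices above the diagonal. -/
def upperIndices : Finset (Fin l × Fin l) := Finset.univ.filter fun p => p.1 < p.2

/-- A polynomial map onto a dense part of the triangular locus. -/
noncomputable def pairPoly (k₀ : κ) (M : κ → Matrix (Fin l) (Fin l) ℂ) : PairSpace κ l :=
  (fun k => (1 + offPart (M k₀)) * (pairFree k₀ M).1 k * (1 + offPart (M k₀)).adjugate,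
    -- The moment equation is linear in the second family. Multiplying that family by the product of
    -- all differences clears the denominators at `k₀`; the adjugate replaces the inverse at the
    -- cost of a factor `det`.
    fun k => (1 + offPart (M k₀)) * (if k = k₀ then Matrix.of fun i j => if i < j then
        (∏ p ∈ (upperIndices l).erase (i, j), diagDiff (M k₀) p) * pairRest k₀ (pairFree k₀ M) i j
        else 0
      else (∏ p ∈ upperIndices l, diagDiff (M k₀) p) • lowerPart (M k)) *
        (1 + offPart (M k₀)).adjugate)

theorem pairPoly_mem (k₀ : κ) (φ : Module.Dual ℂ (PairSpace κ l)) :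
    (fun M => φ (pairPoly k₀ M)) ∈ polyFun (κ → Matrix (Fin l) (Fin l) ℂ) := by
  have hP : EntriesIn (polyFun (κ → Matrix (Fin l) (Fin l) ℂ)) fun M => 1 + offPart (M k₀) :=
    (EntriesIn.const 1).add (entriesIn_linear offPart k₀)
  have hD : ∀ s : Finset (Fin l × Fin l), (fun M : κ → Matrix (Fin l) (Fin l) ℂ =>
      ∏ p ∈ s, diagDiff (M k₀) p) ∈ polyFun (κ → Matrix (Fin l) (Fin l) ℂ) := fun s => by
    have : (fun M : κ → Matrix (Fin l) (Fin l) ℂ => ∏ p ∈ s, diagDiff (M k₀) p) =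
        ∏ p ∈ s, ((fun M => M k₀ p.2 p.2) - fun M => M k₀ p.1 p.1) := by
      ext M
      simp [diagDiff]
    rw [this]
    exact prod_mem fun p _ => sub_mem (entriesIn_linear LinearMap.id k₀ _ _)
      (entriesIn_linear LinearMap.id k₀ _ _)
  have h1 : ∀ k, EntriesIn (polyFun (κ → Matrix (Fin l) (Fin l) ℂ))
      fun M => (pairFree k₀ M : PairSpace κ l).1 k := fun k => by
    by_cases h : k = k₀
    · simpa only [pairFree, h, if_true] using entriesIn_linear diagPart k₀
    · simpa only [pairFree, h, if_false] using entriesIn_linear upperPart k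
  have h2 : ∀ k, EntriesIn (polyFun (κ → Matrix (Fin l) (Fin l) ℂ))
      fun M => (pairFree k₀ M : PairSpace κ l).2 k := fun k => by
    by_cases h : k = k₀
    · simpa only [pairFree, h, if_true] using EntriesIn.const 0
    · simpa only [pairFree, h, if_false] using entriesIn_linear lowerPart k
  refine pairSpace_dual_comp_mem (fun k => (hP.mul (h1 k)).mul hP.adjugate) (fun k => ?_) φ
  refine (hP.mul ?_).mul hP.adjugate
  by_cases h : k = k₀
  · simp only [h, if_true]
    intro i j
    simp only [Matrix.of_apply]
    split_ifs with hij
    · exact mul_mem (hD _)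
        (EntriesIn.sum (fun k _ => ((h1 k).mul (h2 k)).sub ((h2 k).mul (h1 k))) i j)
    · exact zero_mem _
  · simp only [h, if_false]
    exact (entriesIn_linear lowerPart k).smul (hD _)

theorem IsNormalForm.exists_poly {k₀ : κ} {b : PairSpace κ l} (hb : IsNormalForm k₀ b)
    {P : Matrix (Fin l) (Fin l) ℂ} (hP : IsUnit P.det) (hP1 : ∀ i, P i i = 1) :
    ∃ M, pairPoly k₀ M = pairConj P b := by
  set s : ℂ := Ring.inverse P.det with hs
  set δ : ℂ := ∏ p ∈ upperIndices l, diagDiff (s • b.1 k₀) p with hδ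
  have hs0 : s ≠ 0 := by rw [hs, Ring.inverse_eq_inv']; exact inv_ne_zero hP.ne_zero
  have hδ0 : δ ≠ 0 := Finset.prod_ne_zero_iff.2 fun p hp => by
    have hp : p.1 < p.2 := (Finset.mem_filter.1 hp).2
    simp only [diagDiff, Matrix.smul_apply, smul_eq_mul, ← mul_sub]
    exact mul_ne_zero hs0 (sub_ne_zero.2 fun h => hp.ne' (hb.inj k₀ h))
  let M : κ → Matrix (Fin l) (Fin l) ℂ := fun k =>
    if k = k₀ then offPart P + s • b.1 k₀ else s • b.1 k + (s / δ) • (b.2 k)ᵀ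
  have hoff : 1 + offPart (M k₀) = P := by
    ext i j
    by_cases h : i = j
    · subst h; simp [offPart_apply, hP1]
    · simp [M, offPart_apply, h, hb.diag i j h]
  have hdd : ∀ p, diagDiff (M k₀) p = diagDiff (s • b.1 k₀) p := fun p => by
    simp [M, diagDiff, offPart_apply]
  have hC : ∀ k, (pairFree k₀ M : PairSpace κ l).1 k = s • b.1 k := fun k => by
    by_cases h : k = k₀
    · subst h
      ext i j
      by_cases h : i = j
      · subst h; simp [pairFree, M, diagPart_apply, offPart_apply]
      · simp [pairFree, diagPart_apply, h, hb.diag i j h]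
    · ext i j
      by_cases hij : i ≤ j
      · simp [pairFree, M, upperPart_apply, h, hij, hb.strict k j i hij]
      · simp [pairFree, upperPart_apply, h, hij, hb.upper k (not_le.1 hij)]
  have hA : ∀ k ≠ k₀, lowerPart (M k) = (s / δ) • b.2 k := fun k h => by
    ext i j
    by_cases hij : i < j
    · simp [M, lowerPart_apply, h, hij, hb.upper k hij]
    · simp [lowerPart_apply, hij, hb.strict k i j (not_lt.1 hij)]
  have hrest : pairRest k₀ (pairFree k₀ M) = (s * (s / δ)) • pairRest k₀ b := by
    rw [pairRest, pairRest, Finset.smul_sum]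
    refine Finset.sum_congr rfl fun k hk => ?_
    have hk := Finset.ne_of_mem_erase hk
    have : (pairFree k₀ M : PairSpace κ l).2 k = (s / δ) • b.2 k := by
      rw [← hA k hk]; simp [pairFree, hk]
    rw [hC, this]
    simp only [Matrix.smul_mul, Matrix.mul_smul, smul_smul, smul_sub]
    rw [mul_comm s]
  have hconj : ∀ m : Matrix (Fin l) (Fin l) ℂ, P * (s • m) * P.adjugate = P * m * P⁻¹ := fun m => by
    rw [Matrix.inv_def, ← hs]
    simp
  refine ⟨M, Prod.ext (funext fun k => ?_) (funext fun k => ?_)⟩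
  · simp only [pairPoly, hoff, hC, hconj]
    rfl
  · simp only [pairPoly, hoff, hdd, ← hδ, hrest]
    refine (congr_arg (fun m => P * m * P.adjugate) ?_).trans (hconj (b.2 k))
    by_cases h : k = k₀
    · subst h
      ext i j
      simp only [if_true, Matrix.of_apply, Matrix.smul_apply, smul_eq_mul]
      split_ifs with hij
      · have h1 := (pairBracket_eq_zero_iff hb.upper hb.strict hb.diag).1 hb.moment i j hij
        have h2 := Finset.mul_prod_erase (upperIndices l) (diagDiff (s • b.1 k))
          (a := (i, j)) (Finset.mem_filter.2 ⟨Finset.mem_univ _, hij⟩)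
        rw [← hδ] at h2
        rw [← h1]
        have h3 : diagDiff (s • b.1 k) (i, j) = s * (b.1 k j j - b.1 k i i) := by
          simp [diagDiff, mul_sub]
        rw [h3] at h2
        field_simp
        linear_combination (b.2 k i j) * h2
      · rw [hb.strict k i j (not_lt.1 hij), mul_zero]
    · simp only [h, if_false, hA k h, smul_smul]
      rw [mul_div_cancel₀ _ hδ0]

/-- The image of `pairPoly` is dense in the triangular locus. -/
theorem triangularLocus_dense {k₀ : κ} {f : PairSpace κ l → ℂ} (hf : f ∈ polyFun (PairSpace κ l))
    (h0 : ∀ M, f (pairPoly k₀ M) = 0) : ∀ z ∈ triangularLocus l k₀, f z = 0 := by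
  rintro _ ⟨P, hP, b, hb, rfl⟩
  -- With nonzero diagonal entries, `R` is a matrix of unit diagonal times a diagonal matrix, and
  -- the latter is absorbed into the normal form.
  have key : ∀ R : Matrix (Fin l) (Fin l) ℂ, IsUnit R.det → (∀ i, R i i ≠ 0) →
      f (pairConj R b) = 0 := fun R hR hd => by
    set d : Fin l → ℂ := fun i => R i i
    have hu : IsUnit (Matrix.diagonal d).det := by
      simp [Matrix.det_diagonal, Finset.prod_ne_zero_iff, d, hd]
    have e : R = R * Matrix.diagonal (fun i => (d i)⁻¹) * Matrix.diagonal d := by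
      rw [mul_assoc, Matrix.diagonal_mul_diagonal]
      simp [d, hd]
    rw [e, pairConj_mul]
    obtain ⟨M, hM⟩ := (hb.conj_diagonal hd).exists_poly
      (P := R * Matrix.diagonal (fun i => (d i)⁻¹)) (by
        rw [Matrix.det_mul]
        refine hR.mul ?_
        simp [Matrix.det_diagonal, Finset.prod_ne_zero_iff, d, hd]) (fun i => by simp [d, hd])
    rw [← hM, h0]
  -- The diagonal of `P` may contain zeros, but that of `P + t • 1` does not for small `t ≠ 0`; the
  -- value at `t = 0` follows by continuity.
  open scoped Matrix.Norms.Operator in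
  have hdiff : DifferentiableAt ℂ (fun t : ℂ => pairConj (P + t • 1) b) 0 :=
    pairConj_differentiableAt ((differentiableAt_id.smul_const _).const_add P)
      (by simpa using hP) (differentiableAt_const b)
  have hcont : ContinuousAt (fun t : ℂ => f (pairConj (P + t • 1) b)) 0 := by
    refine (polyFun_comp_differentiableAt (γ := fun t : ℂ => pairConj (P + t • 1) b)
      (fun φ => ?_) hf).continuousAt
    open scoped Matrix.Norms.Operator in
    exact (LinearMap.toContinuousLinearMap φ).differentiableAt.comp 0 hdiff
  have h1 : ∀ᶠ t in 𝓝 (0 : ℂ), (P + t • 1).det ≠ 0 := by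
    have : Continuous fun t : ℂ => (P + t • 1).det := by fun_prop
    exact this.continuousAt.eventually_ne (by simpa using hP.ne_zero)
  have h2 : ∀ᶠ t in 𝓝[≠] (0 : ℂ), ∀ i, (P + t • 1) i i ≠ 0 := by
    refine eventually_all.2 fun i => ?_
    by_cases hi : P i i = 0
    · filter_upwards [self_mem_nhdsWithin] with t ht
      simpa [hi] using ht
    · have : Continuous fun t : ℂ => (P + t • 1) i i := by
        simp only [Matrix.add_apply, Matrix.smul_apply]
        fun_prop
      exact (this.continuousAt.eventually_ne (by simpa using hi)).filter_mono nhdsWithin_le_nhds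
  have h3 : (fun t : ℂ => f (pairConj (P + t • 1) b)) =ᶠ[𝓝[≠] 0] fun _ => 0 := by
    filter_upwards [h1.filter_mono nhdsWithin_le_nhds, h2] with t h h'
    exact key _ (isUnit_iff_ne_zero.2 h) h'
  have h4 := tendsto_nhds_unique ((hcont.tendsto.mono_left nhdsWithin_le_nhds).congr' h3)
    tendsto_const_nhds
  simpa using h4

end Polynomial

/-! ### The triangular locus is irreducible and Lagrangian. -/

section Locus

variable {l : ℕ} {κ : Type*} [Fintype κ]

theorem finrank_pairSpace : Module.finrank ℂ (PairSpace κ l) =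
    2 * Module.finrank ℂ (κ → Matrix (Fin l) (Fin l) ℂ) := by
  rw [Module.finrank_prod, two_mul]

variable [DecidableEq κ]

theorem triangularLocus_nonempty (k₀ : κ) : (triangularLocus l k₀).Nonempty := by
  have hM : ∀ _ : κ, Function.Injective fun i : Fin l =>
      (Matrix.diagonal fun i : Fin l => ((i : ℕ) : ℂ)) i i := fun _ i j h =>
    Fin.ext (by simpa using h)
  exact ⟨_, 1, by simp, _, pairParam_normalForm (k₀ := k₀)
    (M := fun _ => Matrix.diagonal fun i : Fin l => ((i : ℕ) : ℂ)) hM, rfl⟩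

variable {W : Type*} [AddCommGroup W] [Module ℂ W]

theorem triangularLocus_irreducible (k₀ : κ) (e : W ≃ₗ[ℂ] PairSpace κ l) :
    IsZariskiIrreducible (e ⁻¹' triangularLocus l k₀) := by
  refine isZariskiIrreducible_of_curves ((triangularLocus_nonempty k₀).preimage e.surjective)
    fun x hx y hy => ?_
  open scoped Matrix.Norms.Operator in
  obtain ⟨γ, s, hs, h0, h1, hx', hy', hγ⟩ := triangularLocus_curves k₀ _ hx _ hy
  refine ⟨fun t => e.symm (γ t), s, hs, h0, h1, by simp [hx'], by simp [hy'], fun t ht => ⟨?_, ?_⟩⟩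
  · simpa using (hγ t ht).1
  · intro φ
    open scoped Matrix.Norms.Operator in
    exact (LinearMap.toContinuousLinearMap (φ ∘ₗ e.symm.toLinearMap)).differentiableAt.comp t
      (hγ t ht).2

/-- The immersion supplies both the isotropic tangent vectors and the lower bound on the dimension;
`pairPoly` supplies the upper bound. -/
theorem triangularLocus_lagrangian (k₀ : κ) (e : W ≃ₗ[ℂ] PairSpace κ l) :
    IsLagrangianVariety (fun v w => pairForm (e v) (e w)) (e ⁻¹' triangularLocus l k₀) := by
  have hfin : FiniteDimensional ℂ W := e.symm.finiteDimensional
  have himm : ∀ x ∈ e ⁻¹' triangularLocus l k₀,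
      (∃ E ≤ zariskiTangent (e ⁻¹' triangularLocus l k₀) x,
        Module.finrank ℂ (κ → Matrix (Fin l) (Fin l) ℂ) ≤ Module.finrank ℂ E ∧
        ∀ v ∈ E, ∀ w ∈ E, pairForm (e v) (e w) = 0) ∧
      (Module.finrank ℂ (κ → Matrix (Fin l) (Fin l) ℂ) : Cardinal) ≤
        Algebra.trdeg ℂ (coordRing (e ⁻¹' triangularLocus l k₀)) := by
    intro x hx
    open scoped Matrix.Norms.Operator in
    obtain ⟨Θ, D, hD, hΘ, h0, hS, hω⟩ := triangularLocus_immersion k₀ hx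
    have hD' : Function.Injective (e.symm.toLinearMap ∘ₗ D) := e.symm.injective.comp hD
    have hS' : ∀ᶠ Y in 𝓝 0, e.symm (Θ Y) ∈ e ⁻¹' triangularLocus l k₀ := by simpa using hS
    open scoped Matrix.Norms.Operator in
    have hΘ' : ∀ φ : Module.Dual ℂ W, HasStrictFDerivAt (fun Y => φ (e.symm (Θ Y)))
        (φ ∘ₗ e.symm.toLinearMap ∘ₗ D).toContinuousLinearMap 0 := fun φ =>
      (LinearMap.toContinuousLinearMap
        (φ ∘ₗ e.symm.toLinearMap)).hasStrictFDerivAt.comp 0 hΘ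
    refine ⟨⟨LinearMap.range (e.symm.toLinearMap ∘ₗ D), ?_, ?_, ?_⟩, ?_⟩
    · rintro _ ⟨Y, rfl⟩
      open scoped Matrix.Norms.Operator in
      have hline : HasDerivAt (fun t : ℂ => t • Y) Y 0 := by
        have h := (hasDerivAt_id (0 : ℂ)).smul_const Y
        rwa [one_smul] at h
      have hx0 : e.symm (Θ ((0 : ℂ) • Y)) = x := by rw [zero_smul, h0, e.symm_apply_apply]
      rw [← hx0]
      refine mem_zariskiTangent_of_curve (γ := fun t : ℂ => e.symm (Θ (t • Y))) (fun φ => ?_) ?_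
      · open scoped Matrix.Norms.Operator in
        have h1 : HasFDerivAt (fun Y => φ (e.symm (Θ Y)))
            (φ ∘ₗ e.symm.toLinearMap ∘ₗ D).toContinuousLinearMap ((0 : ℂ) • Y) := by
          rw [zero_smul]; exact (hΘ' φ).hasFDerivAt
        exact h1.comp_hasDerivAt (0 : ℂ) hline
      · have h1 : Tendsto (fun t : ℂ => t • Y) (𝓝 0) (𝓝 0) := by
          have h := hline.continuousAt.tendsto
          rwa [zero_smul] at h
        exact h1.eventually hS'
    · rw [LinearMap.finrank_range_of_inj hD']
    · rintro _ ⟨Y, rfl⟩ _ ⟨Y', rfl⟩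
      simpa using hω Y Y'
    · open scoped Matrix.Norms.Operator in
      exact finrank_le_trdeg_of_immersion hD' hΘ' hS'
  refine isLagrangianVariety_of_isotropic (triangularLocus_irreducible k₀ e)
    (n := Module.finrank ℂ (κ → Matrix (Fin l) (Fin l) ℂ)) (le_antisymm ?_ ?_) ?_
    fun x hx => (himm x hx).1
  · refine trdeg_coordRing_le (Ψ := fun M => e.symm (pairPoly k₀ M))
      (fun φ => pairPoly_mem k₀ (φ ∘ₗ e.symm.toLinearMap)) fun f hf hf0 z hz => ?_
    have := triangularLocus_dense (f := fun b => f (e.symm b))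
      (polyFun_comp_mem (polyFun (PairSpace κ l)) (Ψ := e.symm)
        (fun φ => polyFun_of_dual (φ ∘ₗ e.symm.toLinearMap)) hf) hf0 _ hz
    simpa using this
  · obtain ⟨x, hx⟩ := (triangularLocus_nonempty k₀).preimage e.surjective
    exact (himm x hx).2
  · rw [e.finrank_eq, finrank_pairSpace]

end Locus

/-! ### Complete flags, adapted bases and triangular matrices. -/

section Flags

variable {l : ℕ}

theorem Matrix.IsUpperTriangular.nodup_roots_charpoly {m : Matrix (Fin l) (Fin l) ℂ}
    (hm : m.IsUpperTriangular) :
    m.charpoly.roots.Nodup ↔ Function.Injective fun i => m i i := by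
  have h : m.charpoly.roots = Finset.univ.val.map fun i => m i i := by
    rw [Matrix.charpoly_of_isUpperTriangular m hm, ← Polynomial.roots_multiset_prod_X_sub_C
      (Finset.univ.val.map fun i => m i i), Multiset.map_map]
    rfl
  rw [h]
  refine ⟨fun h i j hij => ?_, fun h => Finset.univ.nodup.map h⟩
  exact Multiset.inj_on_of_nodup_map h i (Finset.mem_univ_val i) j (Finset.mem_univ_val j) hij

variable {U : Type*} [AddCommGroup U] [Module ℂ U]

theorem finrank_span_initial {w : Fin l → U} (hli : LinearIndependent ℂ w) {k : ℕ} (hk : k ≤ l) :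
    Module.finrank ℂ (Submodule.span ℂ (w '' {i | (i : ℕ) < k})) = k := by
  have h : w '' {i | (i : ℕ) < k} = Set.range (w ∘ Fin.castLE hk) := by
    ext x
    constructor
    · rintro ⟨i, hi, rfl⟩
      exact ⟨⟨i, hi⟩, rfl⟩
    · rintro ⟨i, rfl⟩
      exact ⟨_, i.2, rfl⟩
  rw [h, finrank_span_eq_card (hli.comp _ (Fin.castLE_injective hk)), Fintype.card_fin]


/-- The flag spanned by the initial segments of a basis. -/
def basisFlag (v : Module.Basis (Fin l) ℂ U) (k : ℕ) : Submodule ℂ U :=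
  Submodule.span ℂ (v '' {i | (i : ℕ) < k})

theorem basisFlag_mono (v : Module.Basis (Fin l) ℂ U) : Monotone (basisFlag v) := fun _ _ h =>
  Submodule.span_mono (Set.image_mono fun _ hi => lt_of_lt_of_le hi h)

theorem finrank_basisFlag (v : Module.Basis (Fin l) ℂ U) {k : ℕ} (hk : k ≤ l) :
    Module.finrank ℂ (basisFlag v k) = k := by
  exact finrank_span_initial v.linearIndependent hk

theorem basisFlag_map_le (v : Module.Basis (Fin l) ℂ U) {c : U →ₗ[ℂ] U}
    (hc : (LinearMap.toMatrix v v c).IsUpperTriangular) (k : ℕ) :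
    (basisFlag v k).map c ≤ basisFlag v k := by
  rw [basisFlag, Submodule.map_span, Submodule.span_le]
  rintro _ ⟨_, ⟨j, hj, rfl⟩, rfl⟩
  refine (Module.Basis.mem_span_image v).2 fun i hi => ?_
  have h := Finsupp.mem_support_iff.1 hi
  rw [← LinearMap.toMatrix_apply] at h
  exact lt_of_le_of_lt (Fin.le_def.1 (not_lt.1 fun h' => h (hc h'))) hj

theorem basisFlag_map_lt (v : Module.Basis (Fin l) ℂ U) {a : U →ₗ[ℂ] U}
    (ha : IsStrictUpper (LinearMap.toMatrix v v a)) (k : ℕ) :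
    (basisFlag v (k + 1)).map a ≤ basisFlag v k := by
  rw [basisFlag, Submodule.map_span, Submodule.span_le]
  rintro _ ⟨_, ⟨j, hj, rfl⟩, rfl⟩
  refine (Module.Basis.mem_span_image v).2 fun i hi => ?_
  have h := Finsupp.mem_support_iff.1 hi
  rw [← LinearMap.toMatrix_apply] at h
  exact lt_of_lt_of_le (Fin.lt_def.1 (not_le.1 fun h' => h (ha i j h'))) (Nat.lt_succ_iff.1 hj)

variable [FiniteDimensional ℂ U]

theorem flag_eq_span {F : ℕ → Submodule ℂ U} (hF : Monotone F)
    (hdim : ∀ k ≤ l, Module.finrank ℂ (F k) = k) {w : Fin l → U} (hw : ∀ i, w i ∈ F (i.1 + 1))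
    (hli : LinearIndependent ℂ w) (k : ℕ) (hk : k ≤ l) :
    F k = Submodule.span ℂ (w '' {i | (i : ℕ) < k}) := by
  symm
  refine Submodule.eq_of_le_of_finrank_le (Submodule.span_le.2 ?_) ?_
  · rintro _ ⟨i, hi, rfl⟩
    exact hF (Nat.succ_le_of_lt hi) (hw i)
  · rw [hdim k hk]
    exact (finrank_span_initial hli hk).ge

/-- A basis adapted to a flag, in the sense that `F k` is spanned by the first `k` vectors. -/
theorem exists_flag_basis (hl : Module.finrank ℂ U = l) {F : ℕ → Submodule ℂ U} (hF : Monotone F)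
    (hdim : ∀ k ≤ l, Module.finrank ℂ (F k) = k) :
    ∃ w : Module.Basis (Fin l) ℂ U, ∀ i, w i ∈ F (i.1 + 1) := by
  have hex : ∀ i : Fin l, ∃ x ∈ F (i + 1), x ∉ F i := fun i => by
    by_contra! h
    have := Submodule.finrank_mono (R := ℂ) h
    rw [hdim _ i.2, hdim _ i.2.le] at this
    omega
  choose w hw hw' using hex
  have hspan : ∀ k ≤ l, F k ≤ Submodule.span ℂ (w '' {i | (i : ℕ) < k}) := by
    intro k
    induction k with
    | zero =>
      intro _
      have := Submodule.finrank_eq_zero.1 (hdim 0 (Nat.zero_le l))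
      rw [this]
      exact bot_le
    | succ k ih =>
      intro hk
      have h1 : Submodule.span ℂ (w '' {i | (i : ℕ) < k + 1}) ≤ F (k + 1) := by
        refine Submodule.span_le.2 ?_
        rintro _ ⟨i, hi, rfl⟩
        exact hF (Nat.succ_le_of_lt hi) (hw i)
      -- The new vector is not in `F k`, so this span is strictly larger; lying in `F (k + 1)`, it
      -- must equal it by dimension.
      have h2 : F k < Submodule.span ℂ (w '' {i | (i : ℕ) < k + 1}) := by
        refine lt_of_le_of_ne ((ih (by omega)).trans (Submodule.span_mono
          (Set.image_mono fun i (hi : (i : ℕ) < k) => hi.trans (Nat.lt_succ_self k)))) fun h => ?_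
        refine hw' ⟨k, hk⟩ ?_
        have : w ⟨k, hk⟩ ∈ Submodule.span ℂ (w '' {i | (i : ℕ) < k + 1}) :=
          Submodule.subset_span ⟨⟨k, hk⟩, Nat.lt_succ_self k, rfl⟩
        rwa [← h] at this
      refine (Submodule.eq_of_le_of_finrank_le h1 ?_).ge
      have := Submodule.finrank_lt_finrank_of_lt h2
      rw [hdim k (by omega)] at this
      rw [hdim _ hk]
      exact this
  have htop : ⊤ ≤ Submodule.span ℂ (Set.range w) := by
    have h1 : F l = ⊤ := Submodule.eq_top_of_finrank_eq (by rw [hdim l le_rfl, hl])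
    rw [← h1]
    exact (hspan l le_rfl).trans (Submodule.span_mono (Set.image_subset_range _ _))
  have hli := linearIndependent_of_top_le_span_of_card_eq_finrank htop (by simp [hl])
  exact ⟨Module.Basis.mk hli htop, fun i => by simpa using hw i⟩

theorem repr_eq_zero_of_mem_flag {F : ℕ → Submodule ℂ U} (hF : Monotone F)
    (hdim : ∀ k ≤ l, Module.finrank ℂ (F k) = k) {w : Module.Basis (Fin l) ℂ U}
    (hw : ∀ i, w i ∈ F (i.1 + 1)) {k : ℕ} {x : U} (hx : x ∈ F k) {i : Fin l} (hi : k ≤ i) :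
    w.repr x i = 0 := by
  rw [flag_eq_span hF hdim hw w.linearIndependent k (hi.trans i.2.le),
    Module.Basis.mem_span_image] at hx
  by_contra h
  exact absurd (hx (Finsupp.mem_support_iff.2 h)) (not_lt.2 hi)

theorem toMatrix_upper_of_flag {F : ℕ → Submodule ℂ U} (hF : Monotone F)
    (hdim : ∀ k ≤ l, Module.finrank ℂ (F k) = k) {w : Module.Basis (Fin l) ℂ U}
    (hw : ∀ i, w i ∈ F (i.1 + 1)) {c : U →ₗ[ℂ] U} (hc : ∀ k, (F k).map c ≤ F k) :
    (LinearMap.toMatrix w w c).IsUpperTriangular := by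
  intro i j hij
  rw [LinearMap.toMatrix_apply]
  exact repr_eq_zero_of_mem_flag hF hdim hw (hc _ ⟨_, hw j, rfl⟩) hij

theorem toMatrix_strict_of_flag {F : ℕ → Submodule ℂ U} (hF : Monotone F)
    (hdim : ∀ k ≤ l, Module.finrank ℂ (F k) = k) {w : Module.Basis (Fin l) ℂ U}
    (hw : ∀ i, w i ∈ F (i.1 + 1)) {a : U →ₗ[ℂ] U} (ha : ∀ k, (F (k + 1)).map a ≤ F k) :
    IsStrictUpper (LinearMap.toMatrix w w a) := by
  intro i j hij
  rw [LinearMap.toMatrix_apply]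
  exact repr_eq_zero_of_mem_flag hF hdim hw (ha _ ⟨_, hw j, rfl⟩) hij

/-- A regular semisimple endomorphism that preserves a flag is diagonal in a basis adapted to
the flag. -/
theorem exists_flag_eigenbasis (hl : Module.finrank ℂ U = l) {F : ℕ → Submodule ℂ U}
    (hF : Monotone F) (hdim : ∀ k ≤ l, Module.finrank ℂ (F k) = k) {c : U →ₗ[ℂ] U}
    (hc : ∀ k, (F k).map c ≤ F k) (hreg : IsRegularSemisimple c) :
    ∃ v : Module.Basis (Fin l) ℂ U, (∀ i, v i ∈ F (i.1 + 1)) ∧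
      ∀ i j, i ≠ j → LinearMap.toMatrix v v c i j = 0 := by
  obtain ⟨w, hw⟩ := exists_flag_basis hl hF hdim
  set m := LinearMap.toMatrix w w c with hm
  have hmu : m.IsUpperTriangular := toMatrix_upper_of_flag hF hdim hw hc
  have hinj : Function.Injective fun i => m i i := by
    rw [← hmu.nodup_roots_charpoly, hm, LinearMap.charpoly_toMatrix]
    exact hreg
  -- Triangularity: `c` acts on the one-dimensional quotient `F (i + 1) / F i` by the scalar `m i
  -- i`.
  have hlow : ∀ i : Fin l, ∀ x ∈ F (i + 1), c x - m i i • x ∈ F i := by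
    intro i x hx
    rw [flag_eq_span hF hdim hw w.linearIndependent _ i.2] at hx
    have hle : Submodule.span ℂ (w '' {j | (j : ℕ) < i + 1}) ≤
        (F i).comap (c - m i i • LinearMap.id) := by
      refine Submodule.span_le.2 ?_
      rintro _ ⟨j, hj, rfl⟩
      simp only [Submodule.comap_coe, Set.mem_preimage, LinearMap.sub_apply, LinearMap.smul_apply,
        LinearMap.id_apply, SetLike.mem_coe]
      rcases Nat.lt_succ_iff_lt_or_eq.1 hj with hj | hj
      · have : w j ∈ F i := hF (Nat.succ_le_of_lt hj) (hw j)
        exact sub_mem (hc _ ⟨_, this, rfl⟩) (Submodule.smul_mem _ _ this)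
      · obtain rfl : j = i := Fin.ext hj
        rw [flag_eq_span hF hdim hw w.linearIndependent _ j.2.le, Module.Basis.mem_span_image]
        intro k hk
        by_contra hkj
        refine Finsupp.mem_support_iff.1 hk ?_
        have hkj : j ≤ k := not_lt.1 hkj
        have e : w.repr (c (w j)) k = m k j := (LinearMap.toMatrix_apply w w c k j).symm
        rw [map_sub, map_smul, Finsupp.sub_apply, e]
        rcases hkj.lt_or_eq with h | rfl
        · rw [hmu h]; simp [h.ne]
        · simp
    exact hle hx
  -- The dimension drops by one under `c - m i i`, so the kernel contains an eigenvector inside `F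
  -- (i + 1)`. Distinct eigenvalues make these vectors a basis.
  have hex : ∀ i : Fin l, ∃ x ∈ F (i + 1), x ≠ 0 ∧ c x = m i i • x := by
    intro i
    let g : F (i + 1) →ₗ[ℂ] F i :=
      LinearMap.codRestrict (F i) ((c - m i i • LinearMap.id) ∘ₗ (F (i + 1)).subtype)
        fun x => hlow i x x.2
    have hker := LinearMap.ker_ne_bot_of_finrank_lt (f := g)
      (by rw [hdim _ i.2, hdim _ i.2.le]; exact Nat.lt_succ_self _)
    obtain ⟨x, hx, hx0⟩ := Submodule.exists_mem_ne_zero_of_ne_bot hker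
    refine ⟨x, x.2, fun h => hx0 (Subtype.ext h), ?_⟩
    have := congr_arg Subtype.val (LinearMap.mem_ker.1 hx)
    exact sub_eq_zero.1 this
  choose v hvF hv0 hv using hex
  have hli : LinearIndependent ℂ v := Module.End.eigenvectors_linearIndependent' c (fun i => m i i)
    hinj v fun i => ⟨Module.End.mem_eigenspace_iff.2 (hv i), hv0 i⟩
  let b := Module.Basis.mk hli (hli.span_eq_top_of_card_eq_finrank' (by simp [hl])).ge
  have hb : ∀ i, b i = v i := fun i => by simp [b]
  refine ⟨b, fun i => by rw [hb]; exact hvF i, fun i j hij => ?_⟩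
  rw [LinearMap.toMatrix_apply, hb, hv, ← hb, map_smul]
  simp [hij.symm]

end Flags

theorem finsum_eq_sum_of_range {α ι M : Type*} [Fintype ι] [AddCommMonoid M] {j : ι → α}
    (hj : Function.Injective j) {f : α → M} (hf : ∀ a, a ∉ Set.range j → f a = 0) :
    ∑ᶠ a, f a = ∑ x, f (j x) := by
  rw [← finsum_eq_sum_of_fintype, ← finsum_mem_range hj]
  refine finsum_congr fun a => ?_
  by_cases h : a ∈ Set.range j
  · simp only [h, finsum_true]
  · simp only [h, finsum_false, hf a h]

/-! ### Transport of maps to endomorphisms of one vertex space. -/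

section HomCast

variable {I : Type*} {V : I → Type*} [∀ i, AddCommGroup (V i)] [∀ i, Module ℂ (V i)] {i j j' : I}

/-- A map between spaces of the family that are equal to `V i`, as an endomorphism of `V i`. -/
def homCast (hj : j = i) (hj' : j' = i) : (V j →ₗ[ℂ] V j') ≃ₗ[ℂ] Module.End ℂ (V i) :=
  LinearEquiv.arrowCongr (LinearEquiv.cast (R := ℂ) (M := V) hj)
    (LinearEquiv.cast (R := ℂ) (M := V) hj')

theorem homCast_comp {j'' : I} (hj : j = i) (hj' : j' = i) (hj'' : j'' = i) (f : V j →ₗ[ℂ] V j')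
    (g : V j' →ₗ[ℂ] V j'') :
    homCast hj hj'' (g ∘ₗ f) = homCast hj' hj'' g * homCast hj hj' f := by
  subst hj hj' hj''; rfl

theorem homCast_cast_comp {k k' : I} (hj : j = i) (hj' : j' = i) (hk : k = i) (hk' : k' = i)
    (e : k = j) (e' : j' = k') (f : V j →ₗ[ℂ] V j') :
    homCast hk hk' ((LinearEquiv.cast (R := ℂ) (M := V) e').toLinearMap ∘ₗ f ∘ₗ
      (LinearEquiv.cast (R := ℂ) (M := V) e).toLinearMap) = homCast hj hj' f := by
  subst hj hj' hk'; cases e; rfl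

theorem trace_homCast (hj : j = i) (f : V j →ₗ[ℂ] V j) :
    LinearMap.trace ℂ (V i) (homCast hj hj f) = LinearMap.trace ℂ (V j) f := by
  subst hj; rfl

theorem cast_conj_eq_homCast (hj : j = i) (f : V j →ₗ[ℂ] V j) :
    (LinearEquiv.cast (R := ℂ) (M := V) hj).conj f = homCast hj hj f := by
  subst hj; rfl

theorem map_le_iff_homCast (hj : j = i) (hj' : j' = i) (f : V j →ₗ[ℂ] V j')
    (F F' : ∀ i, Submodule ℂ (V i)) :
    (F j).map f ≤ F' j' ↔ (F i).map (homCast hj hj' f) ≤ F' i := by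
  subst hj hj'; rfl

theorem isRegularSemisimple_homCast [∀ i, FiniteDimensional ℂ (V i)] (hj : j = i) (hj' : j' = i)
    (e : j = j') (f : V j →ₗ[ℂ] V j') :
    IsRegularSemisimple ((LinearEquiv.cast (R := ℂ) (M := V) e.symm).toLinearMap ∘ₗ f) ↔
      IsRegularSemisimple (homCast hj hj' f) := by
  subst hj hj'; rfl

end HomCast

/-! ### Reduction of quiver data to the loops at one vertex. -/

namespace OrientedQuiver

variable {I H : Type*} (Q : OrientedQuiver I H) (i : I)

/-- The loops at `i` that belong to the orientation. -/
def LoopIndex := {h : H // Q.out h = i ∧ Q.sink h = i ∧ h ∈ Q.Ω}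

instance : Finite (Q.LoopIndex i) :=
  ((Q.finite_arrows i i).subset fun _ h => ⟨h.1, h.2.1⟩ :
    {h : H | Q.out h = i ∧ Q.sink h = i ∧ h ∈ Q.Ω}.Finite)

/-- All the loops at `i`: those of the orientation and their opposites. -/
def loopArrow : Q.LoopIndex i ⊕ Q.LoopIndex i → H :=
  Sum.elim (fun k => k.1) fun k => Q.bar k.1

theorem bar_injective : Function.Injective Q.bar := fun h h' e => by
  rw [← Q.bar_bar h, e, Q.bar_bar]

variable {i}

theorem bar_notMem (k : Q.LoopIndex i) : Q.bar k.1 ∉ Q.Ω := fun h =>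
  (Q.bar_mem_iff _).1 h k.2.2.2

theorem loopArrow_injective : Function.Injective (Q.loopArrow i) := by
  rintro (k | k) (k' | k') h
  · exact congr_arg Sum.inl (Subtype.ext h)
  · exact absurd k.2.2.2 ((show k.1 = Q.bar k'.1 from h) ▸ Q.bar_notMem k')
  · exact absurd k'.2.2.2 ((show Q.bar k.1 = k'.1 from h) ▸ Q.bar_notMem k)
  · exact congr_arg Sum.inr (Subtype.ext (Q.bar_injective h))

theorem range_loopArrow : Set.range (Q.loopArrow i) = {h | Q.out h = i ∧ Q.sink h = i} := by
  ext h
  constructor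
  · rintro ⟨k | k, rfl⟩
    · exact ⟨k.2.1, k.2.2.1⟩
    · exact ⟨(Q.out_bar _).trans k.2.2.1, (Q.sink_bar _).trans k.2.1⟩
  · rintro ⟨h1, h2⟩
    by_cases hΩ : h ∈ Q.Ω
    · exact ⟨Sum.inl ⟨h, h1, h2, hΩ⟩, rfl⟩
    · exact ⟨Sum.inr ⟨Q.bar h, (Q.out_bar h).trans h2, (Q.sink_bar h).trans h1,
        (Q.bar_mem_iff h).2 hΩ⟩, Q.bar_bar h⟩

/-- The involution matches the loops of `Ω` with the remaining loops, so `c_ii = 2` means a single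
index. -/
theorem numArrows_self : Q.numArrows i i = 2 * Nat.card (Q.LoopIndex i) := by
  rw [numArrows, ← Q.range_loopArrow, ← Set.image_univ, Set.ncard_image_of_injective _
    Q.loopArrow_injective, Set.ncard_univ, Nat.card_sum, two_mul]

theorem finsum_loops [Fintype (Q.LoopIndex i)] {M : Type*} [AddCommMonoid M] {f : H → M}
    (hf : ∀ h, ¬ (Q.out h = i ∧ Q.sink h = i) → f h = 0) :
    ∑ᶠ h, f h = ∑ k : Q.LoopIndex i, (f k.1 + f (Q.bar k.1)) := by
  rw [finsum_eq_sum_of_range Q.loopArrow_injective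
    (fun h hh => hf h (by rwa [range_loopArrow] at hh)), Fintype.sum_sum_type,
    Finset.sum_add_distrib]
  rfl

variable {V : I → Type*} [∀ j, AddCommGroup (V j)] [∀ j, Module ℂ (V j)]

theorem homCast_congr (B : Q.RepSpace V) {h h' : H} (e : h = h') (h1 : Q.out h = i)
    (h2 : Q.sink h = i) (h1' : Q.out h' = i) (h2' : Q.sink h' = i) :
    homCast h1 h2 (B h) = homCast h1' h2' (B h') := by
  subst e; rfl

theorem homCast_barMap (B : Q.RepSpace V) {h h' : H} (e : Q.bar h = h') (h1 : Q.sink h = i)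
    (h2 : Q.out h = i) (h1' : Q.out h' = i) (h2' : Q.sink h' = i) :
    homCast h1 h2 (Q.barMap B h) = homCast h1' h2' (B h') := by
  subst e
  exact homCast_cast_comp _ _ _ _ _ _ _

/-- The endomorphism of `V i` at a loop of the orientation. -/
def loopMap (B : Q.RepSpace V) (k : Q.LoopIndex i) : Module.End ℂ (V i) :=
  homCast k.2.1 k.2.2.1 (B k.1)

/-- The endomorphism of `V i` at the opposite of a loop of the orientation. -/
def barLoopMap (B : Q.RepSpace V) (k : Q.LoopIndex i) : Module.End ℂ (V i) :=
  homCast ((Q.out_bar _).trans k.2.2.1) ((Q.sink_bar _).trans k.2.1) (B (Q.bar k.1))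

theorem barLoopMap_bar (B : Q.RepSpace V) {a : H} (h1 : Q.out a = i) (h2 : Q.sink a = i)
    (h : Q.out (Q.bar a) = i ∧ Q.sink (Q.bar a) = i ∧ Q.bar a ∈ Q.Ω) :
    Q.barLoopMap B ⟨Q.bar a, h⟩ = homCast h1 h2 (B a) :=
  Q.homCast_congr B (Q.bar_bar a) _ _ h1 h2

theorem sign_loop (k : Q.LoopIndex i) : Q.sign k.1 = 1 := if_pos k.2.2.2

theorem sign_bar_loop (k : Q.LoopIndex i) : Q.sign (Q.bar k.1) = -1 := if_neg (Q.bar_notMem k)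

theorem homCast_barMap_comp (B B' : Q.RepSpace V) (k : Q.LoopIndex i) (h : Q.out k.1 = i) :
    homCast h h (Q.barMap B k.1 ∘ₗ B' k.1) = Q.barLoopMap B k * Q.loopMap B' k := by
  rw [homCast_comp h k.2.2.1 h, homCast_barMap Q B rfl]
  rfl

theorem homCast_barMap_bar_comp (B B' : Q.RepSpace V) (k : Q.LoopIndex i)
    (h : Q.out (Q.bar k.1) = i) :
    homCast h h (Q.barMap B (Q.bar k.1) ∘ₗ B' (Q.bar k.1)) =
      Q.loopMap B k * Q.barLoopMap B' k := by
  rw [homCast_comp h ((Q.sink_bar _).trans k.2.1) h, homCast_barMap Q B (Q.bar_bar k.1)]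
  rfl

theorem arrow_eq_zero (hV : ∀ j, j ≠ i → Subsingleton (V j))
    (B : Q.RepSpace V) {h : H} (hh : ¬ (Q.out h = i ∧ Q.sink h = i)) :
    B h = 0 := by
  by_cases h1 : Q.out h = i
  · have := hV (Q.sink h) fun h2 => hh ⟨h1, h2⟩
    exact Subsingleton.elim _ _
  · have := hV (Q.out h) h1
    exact Subsingleton.elim _ _

theorem symplecticForm_eq [Fintype (Q.LoopIndex i)]
    (hV : ∀ j, j ≠ i → Subsingleton (V j)) (B B' : Q.RepSpace V) :
    Q.symplecticForm B B' = ∑ k : Q.LoopIndex i,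
      (LinearMap.trace ℂ (V i) (Q.barLoopMap B k * Q.loopMap B' k) -
        LinearMap.trace ℂ (V i) (Q.loopMap B k * Q.barLoopMap B' k)) := by
  rw [symplecticForm, Q.finsum_loops (i := i)]
  · refine Finset.sum_congr rfl fun k _ => ?_
    have h1 : Q.out k.1 = i := k.2.1
    have h2 : Q.out (Q.bar k.1) = i := (Q.out_bar _).trans k.2.2.1
    rw [sign_loop, sign_bar_loop, ← trace_homCast h1, ← trace_homCast h2, homCast_barMap_comp,
      homCast_barMap_bar_comp]
    ring
  · intro h hh
    rw [Q.arrow_eq_zero hV B' hh, LinearMap.comp_zero, map_zero, mul_zero]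

theorem momentMap_eq [Fintype (Q.LoopIndex i)]
    (hV : ∀ j, j ≠ i → Subsingleton (V j)) (B : Q.RepSpace V) :
    Q.momentMap B i = ∑ k : Q.LoopIndex i,
      (Q.barLoopMap B k * Q.loopMap B k - Q.loopMap B k * Q.barLoopMap B k) := by
  let j : Q.LoopIndex i ⊕ Q.LoopIndex i → {h : H // Q.out h = i} := fun x =>
    ⟨Q.loopArrow i x, ((Set.ext_iff.1 Q.range_loopArrow _).1 ⟨x, rfl⟩).1⟩
  have hj : Function.Injective j := fun x y h => Q.loopArrow_injective (congr_arg Subtype.val h)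
  rw [momentMap, finsum_eq_sum_of_range hj, Fintype.sum_sum_type, ← Finset.sum_add_distrib]
  · refine Finset.sum_congr rfl fun k _ => ?_
    rw [cast_conj_eq_homCast, cast_conj_eq_homCast]
    have e1 := Q.homCast_barMap_comp B B k k.2.1
    have e2 := Q.homCast_barMap_bar_comp B B k ((Q.out_bar _).trans k.2.2.1)
    refine (congr_arg₂ (fun x y => Q.sign k.1 • x + Q.sign (Q.bar k.1) • y) e1 e2).trans ?_
    rw [sign_loop, sign_bar_loop, one_smul, neg_one_smul, sub_eq_add_neg]
  · intro h hh
    have : B h.1 = 0 := Q.arrow_eq_zero hV B fun hl => by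
      obtain ⟨x, hx⟩ := (Set.ext_iff.1 Q.range_loopArrow _).2 hl
      exact hh ⟨x, Subtype.ext hx⟩
    rw [this, LinearMap.comp_zero, map_zero, smul_zero]

theorem finsum_finrank (hV : ∀ j, j ≠ i → Subsingleton (V j))
    (F : ∀ j, Submodule ℂ (V j)) :
    ∑ᶠ j, Module.finrank ℂ (F j) = Module.finrank ℂ (F i) :=
  finsum_eq_single _ i fun j hj => by
    have := hV j hj
    exact Module.finrank_zero_of_subsingleton

/-- The flags of `V i`, extended to graded flags. -/
theorem exists_graded_flag [∀ j, FiniteDimensional ℂ (V j)]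
    (hV : ∀ j, j ≠ i → Subsingleton (V j)) {l : ℕ} (hl : Module.finrank ℂ (V i) = l)
    {F : ℕ → Submodule ℂ (V i)} (hF : Monotone F) (hdim : ∀ k ≤ l, Module.finrank ℂ (F k) = k) :
    ∃ F' : ℕ → ∀ j, Submodule ℂ (V j), IsCompleteFlag V F' ∧ ∀ k, F' k i = F k := by
  classical
  let F' : ℕ → ∀ j, Submodule ℂ (V j) := fun k j =>
    -- Away from `i` the spaces are zero, so `⊤` adds nothing to the total dimension.
    if hj : j = i then (F k).comap (LinearEquiv.cast (R := ℂ) (M := V) hj).toLinearMap else ⊤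
  have hF' : ∀ k, F' k i = F k := fun k => by
    simp only [F', dif_pos]
    rfl
  have hsum : ∑ᶠ j, Module.finrank ℂ (V j) = l := by
    rw [finsum_eq_single _ i fun j hj => ?_, hl]
    have := hV j hj
    exact Module.finrank_zero_of_subsingleton
  refine ⟨F', ⟨fun k k' hk j => ?_, fun k hk => ?_, fun k hk j => ?_⟩, hF'⟩
  · by_cases hj : j = i
    · simp only [F', dif_pos hj]
      exact Submodule.comap_mono (hF hk)
    · simp only [F', dif_neg hj, le_refl]
  · rw [finsum_finrank hV, hF', hdim k (hsum ▸ hk)]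
  · by_cases hj : j = i
    · subst hj
      rw [hF']
      refine top_le_iff.1 (le_trans ?_ (hF (hsum ▸ hk : l ≤ k)))
      exact (Submodule.eq_top_of_finrank_eq (by rw [hdim l le_rfl, hl])).ge
    · simp only [F', dif_neg hj]

theorem preservesFlag_iff (hV : ∀ j, j ≠ i → Subsingleton (V j))
    (B : Q.RepSpace V) (F : ℕ → ∀ j, Submodule ℂ (V j)) :
    Q.PreservesFlag B F ↔ ∀ h : Q.LoopIndex i,
      (∀ k, (F k i).map (Q.barLoopMap B h) ≤ F k i) ∧
        ∀ k, (F (k + 1) i).map (Q.loopMap B h) ≤ F k i := by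
  constructor
  · intro h x
    refine ⟨fun k => ?_, fun k => ?_⟩
    · exact (map_le_iff_homCast _ _ _ (F k) (F k)).1 (h.1 _
        ⟨((Q.out_bar _).trans x.2.2.1).trans ((Q.sink_bar _).trans x.2.1).symm, Q.bar_notMem x⟩ k)
    · exact (map_le_iff_homCast _ _ _ (F (k + 1)) (F k)).1 (h.2 _ (fun h => h.2 x.2.2.2) k)
  · intro h
    refine ⟨fun a ha k => ?_, fun a ha k => ?_⟩
    · by_cases hl : Q.out a = i ∧ Q.sink a = i
      · rw [map_le_iff_homCast hl.1 hl.2 _ (F k) (F k)]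
        have h' := (h ⟨Q.bar a, (Q.out_bar a).trans hl.2, (Q.sink_bar a).trans hl.1,
          (Q.bar_mem_iff a).2 ha.2⟩).1 k
        rwa [Q.barLoopMap_bar B hl.1 hl.2] at h'
      · rw [Q.arrow_eq_zero hV B hl, Submodule.map_zero]
        exact bot_le
    · by_cases hl : Q.out a = i ∧ Q.sink a = i
      · rw [map_le_iff_homCast hl.1 hl.2 _ (F (k + 1)) (F k)]
        have haΩ : a ∈ Q.Ω := by
          by_contra h'
          exact ha ⟨hl.1.trans hl.2.symm, h'⟩
        exact (h ⟨a, hl.1, hl.2, haΩ⟩).2 k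
      · rw [Q.arrow_eq_zero hV B hl, Submodule.map_zero]
        exact bot_le

theorem mem_regularLocus_iff [∀ j, FiniteDimensional ℂ (V j)]
    (hV : ∀ j, j ≠ i → Subsingleton (V j)) (B : Q.RepSpace V) :
    B ∈ Q.regularLocus V ↔ ∀ h : Q.LoopIndex i, IsRegularSemisimple (Q.barLoopMap B h) := by
  constructor
  · intro h x
    have e : Q.IsOppositeLoop (Q.bar x.1) :=
      ⟨((Q.out_bar _).trans x.2.2.1).trans ((Q.sink_bar _).trans x.2.1).symm, Q.bar_notMem x⟩
    exact (isRegularSemisimple_homCast _ _ e.1 _).1 (h (Q.bar x.1) e)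
  · intro h a ha
    by_cases hl : Q.out a = i
    · have hs : Q.sink a = i := ha.1.symm.trans hl
      rw [loopEnd, isRegularSemisimple_homCast hl hs ha.1]
      have h' := h ⟨Q.bar a, (Q.out_bar a).trans hs, (Q.sink_bar a).trans hl,
          (Q.bar_mem_iff a).2 ha.2⟩
      rwa [Q.barLoopMap_bar B hl hs] at h'
    · have := hV _ hl
      -- An opposite loop at another vertex acts on a zero space, where the characteristic
      -- polynomial has no roots.
      have hdeg : (Q.loopEnd B a ha.1).charpoly.natDegree = 0 := by
        rw [LinearMap.charpoly_natDegree]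
        exact Module.finrank_zero_of_subsingleton
      have hroots : (Q.loopEnd B a ha.1).charpoly.roots = 0 := by
        rw [← Multiset.card_eq_zero]
        exact Nat.le_zero.1 (hdeg ▸ Polynomial.card_roots' _)
      rw [IsRegularSemisimple, hroots]
      exact Multiset.nodup_zero

theorem mem_nilVariety_iff [∀ j, FiniteDimensional ℂ (V j)] [Fintype (Q.LoopIndex i)]
    (hV : ∀ j, j ≠ i → Subsingleton (V j)) {l : ℕ} (hl : Module.finrank ℂ (V i) = l)
    (B : Q.RepSpace V) : B ∈ Q.nilVariety V ↔
      (∃ F : ℕ → Submodule ℂ (V i), Monotone F ∧ (∀ k ≤ l, Module.finrank ℂ (F k) = k) ∧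
        ∀ h : Q.LoopIndex i, (∀ k, (F k).map (Q.barLoopMap B h) ≤ F k) ∧
          ∀ k, (F (k + 1)).map (Q.loopMap B h) ≤ F k) ∧
      ∑ k : Q.LoopIndex i,
        (Q.barLoopMap B k * Q.loopMap B k - Q.loopMap B k * Q.barLoopMap B k) = 0 ∧
      ∀ h : Q.LoopIndex i, IsRegularSemisimple (Q.barLoopMap B h) := by
  rw [← Q.momentMap_eq hV, ← Q.mem_regularLocus_iff hV]
  refine and_congr ?_ (and_congr ?_ Iff.rfl)
  · constructor
    · rintro ⟨F, ⟨h1, h2, -⟩, hB⟩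
      refine ⟨fun k => F k i, fun k k' hk => h1 hk i, fun k hk => ?_,
        (Q.preservesFlag_iff hV B F).1 hB⟩
      rw [← finsum_finrank hV (F k)]
      refine h2 k (hk.trans_eq ?_)
      rw [finsum_eq_single _ i fun j hj => ?_, hl]
      have := hV j hj
      exact Module.finrank_zero_of_subsingleton
    · rintro ⟨F, hF, hdim, hB⟩
      obtain ⟨F', hF', hFi⟩ := exists_graded_flag hV hl hF hdim
      refine ⟨F', hF', (Q.preservesFlag_iff hV B F').2 ?_⟩
      simpa only [hFi] using hB
  · refine ⟨fun h => h i, fun h j => ?_⟩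
    by_cases hj : j = i
    · rw [hj, h]
    · have := hV j hj
      exact Subsingleton.elim _ _

end OrientedQuiver

/-! ### Regular semisimple matrices. -/

section MatrixModel

variable {U : Type*} [AddCommGroup U] [Module ℂ U] [FiniteDimensional ℂ U] {l : ℕ}

theorem isRegularSemisimple_iff (b : Module.Basis (Fin l) ℂ U) (f : U →ₗ[ℂ] U) :
    IsRegularSemisimple f ↔ (LinearMap.toMatrix b b f).charpoly.roots.Nodup := by
  rw [LinearMap.charpoly_toMatrix, IsRegularSemisimple]

theorem isRegularSemisimple_toLin'_iff (M : Matrix (Fin l) (Fin l) ℂ) :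
    IsRegularSemisimple (Matrix.toLin' M) ↔ M.charpoly.roots.Nodup := by
  rw [isRegularSemisimple_iff (Pi.basisFun ℂ (Fin l)), LinearMap.toMatrix_eq_toMatrix',
    LinearMap.toMatrix'_toLin']

/-- A regular semisimple endomorphism is diagonalizable. -/
theorem exists_eigenbasis (hl : Module.finrank ℂ U = l) {c : U →ₗ[ℂ] U}
    (hc : IsRegularSemisimple c) :
    ∃ v : Module.Basis (Fin l) ℂ U, (LinearMap.toMatrix v v c).IsUpperTriangular := by
  -- Over `ℂ` the characteristic polynomial has `l` roots with multiplicity; being distinct, they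
  -- give `l` independent eigenvectors.
  have hcard : c.charpoly.roots.toFinset.card = l := by
    rw [Multiset.toFinset_card_of_nodup hc, IsAlgClosed.card_roots_eq_natDegree,
      LinearMap.charpoly_natDegree, hl]
  let d : Fin l ≃ c.charpoly.roots.toFinset := (Finset.equivFinOfCardEq hcard).symm
  have hd : ∀ i, ∃ x, Module.End.HasEigenvector c (d i : ℂ) x := fun i => by
    refine Module.End.HasEigenvalue.exists_hasEigenvector ?_
    rw [Module.End.hasEigenvalue_iff_isRoot_charpoly]
    exact Polynomial.isRoot_of_mem_roots (Multiset.mem_toFinset.1 (d i).2)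
  choose v hv using hd
  have hli : LinearIndependent ℂ v := Module.End.eigenvectors_linearIndependent' c
    (fun i => (d i : ℂ)) (Subtype.val_injective.comp d.injective) v hv
  let b := Module.Basis.mk hli (hli.span_eq_top_of_card_eq_finrank' (by simp [hl])).ge
  have hb : ∀ i, b i = v i := fun i => by simp [b]
  refine ⟨b, fun i j hij => ?_⟩
  rw [LinearMap.toMatrix_apply, hb, (hv j).apply_eq_smul, ← hb, map_smul]
  simp [(show j < i from hij).ne]

end MatrixModel

theorem isRegularMap_of_linear {W W' : Type*} [AddCommGroup W] [Module ℂ W] [AddCommGroup W']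
    [Module ℂ W'] {S : Set W} {T : Set W'} {F : S → T} (f : W →ₗ[ℂ] W')
    (h : ∀ x, (F x : W') = f x) : IsRegularMap S T F := fun φ x =>
  ⟨_, polyFun_of_dual (φ ∘ₗ f), 1, one_mem _, one_ne_zero, fun y _ => by simp [h]⟩

/-! ### Identification of `𝒩` with the triangular locus, and the special cases. -/

namespace OrientedQuiver

variable {I H : Type*} (Q : OrientedQuiver I H) {i : I} {l : ℕ}
variable {V : I → Type*} [∀ j, AddCommGroup (V j)] [∀ j, Module ℂ (V j)]

/-- The matrices of a representation at the loops at `i`. -/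
noncomputable def toPair (b : Module.Basis (Fin l) ℂ (V i)) :
    Q.RepSpace V →ₗ[ℂ] PairSpace (Q.LoopIndex i) l where
  toFun B := (fun k => LinearMap.toMatrix b b (Q.barLoopMap B k),
    fun k => LinearMap.toMatrix b b (Q.loopMap B k))
  map_add' B B' := by ext <;> simp [barLoopMap, loopMap]
  map_smul' c B := by ext <;> simp [barLoopMap, loopMap]

theorem toPair_injective (hV : ∀ j, j ≠ i → Subsingleton (V j))
    (b : Module.Basis (Fin l) ℂ (V i)) : Function.Injective (Q.toPair (V := V) b) := by
  rw [injective_iff_map_eq_zero]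
  intro B hB
  ext1 h
  by_cases hl : Q.out h = i ∧ Q.sink h = i
  · refine (homCast hl.1 hl.2).map_eq_zero_iff.1 ?_
    by_cases hΩ : h ∈ Q.Ω
    · exact (LinearMap.toMatrix b b).map_eq_zero_iff.1
        (congr_fun (congr_arg Prod.snd hB) ⟨h, hl.1, hl.2, hΩ⟩)
    · have h' : Q.out (Q.bar h) = i ∧ Q.sink (Q.bar h) = i ∧ Q.bar h ∈ Q.Ω :=
        ⟨(Q.out_bar h).trans hl.2, (Q.sink_bar h).trans hl.1, (Q.bar_mem_iff h).2 hΩ⟩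
      rw [← Q.barLoopMap_bar B hl.1 hl.2 h']
      exact (LinearMap.toMatrix b b).map_eq_zero_iff.1 (congr_fun (congr_arg Prod.fst hB) ⟨_, h'⟩)
  · exact Q.arrow_eq_zero hV B hl

theorem toPair_surjective (b : Module.Basis (Fin l) ℂ (V i)) :
    Function.Surjective (Q.toPair (V := V) b) := by
  classical
  rintro ⟨C, A⟩
  let B : Q.RepSpace V := fun h =>
    if hl : Q.out h = i ∧ Q.sink h = i then
      (homCast hl.1 hl.2).symm (Matrix.toLin b b
        (if hΩ : h ∈ Q.Ω then A ⟨h, hl.1, hl.2, hΩ⟩ else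
          C ⟨Q.bar h, (Q.out_bar h).trans hl.2, (Q.sink_bar h).trans hl.1,
            (Q.bar_mem_iff h).2 hΩ⟩))
    else 0
  refine ⟨B, Prod.ext (funext fun k => ?_) (funext fun k => ?_)⟩
  · have hl : Q.out (Q.bar k.1) = i ∧ Q.sink (Q.bar k.1) = i :=
      ⟨(Q.out_bar _).trans k.2.2.1, (Q.sink_bar _).trans k.2.1⟩
    simp only [toPair, LinearMap.coe_mk, AddHom.coe_mk, barLoopMap, B, dif_pos hl,
      dif_neg (Q.bar_notMem k), LinearEquiv.apply_symm_apply, LinearMap.toMatrix_toLin]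
    exact congr_arg C (Subtype.ext (Q.bar_bar _))
  · have hl : Q.out k.1 = i ∧ Q.sink k.1 = i := ⟨k.2.1, k.2.2.1⟩
    simp only [toPair, LinearMap.coe_mk, AddHom.coe_mk, loopMap, B, dif_pos hl,
      dif_pos k.2.2.2, LinearEquiv.apply_symm_apply, LinearMap.toMatrix_toLin]
    rfl

/-- If `V` is concentrated at the vertex `i`, a representation is determined by its matrices at the
loops at `i`. -/
noncomputable def pairEquiv (hV : ∀ j, j ≠ i → Subsingleton (V j))
    (b : Module.Basis (Fin l) ℂ (V i)) : Q.RepSpace V ≃ₗ[ℂ] PairSpace (Q.LoopIndex i) l :=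
  LinearEquiv.ofBijective (Q.toPair b) ⟨Q.toPair_injective hV b, Q.toPair_surjective b⟩

theorem toPair_basis (b v : Module.Basis (Fin l) ℂ (V i)) (B : Q.RepSpace V) :
    Q.toPair b B = pairConj (b.toMatrix v) (Q.toPair v B) := by
  have hinv : (b.toMatrix v)⁻¹ = v.toMatrix b :=
    Matrix.inv_eq_right_inv (b.toMatrix_mul_toMatrix_flip v)
  refine Prod.ext (funext fun k => ?_) (funext fun k => ?_) <;>
  · simp only [toPair, pairConj, LinearMap.coe_mk, AddHom.coe_mk, hinv]
    exact (basis_toMatrix_mul_linearMap_toMatrix_mul_basis_toMatrix _ _ _ _ _).symm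

theorem isUnit_det_toMatrix (b v : Module.Basis (Fin l) ℂ (V i)) :
    IsUnit (b.toMatrix v).det :=
  Matrix.isUnit_det_of_right_inverse (b.toMatrix_mul_toMatrix_flip v)

/-- With `toPair_basis`, this turns conjugation by an invertible matrix into a change of basis, so
conjugating matrices and bases adapted to flags are interchangeable. -/
theorem exists_basis_toMatrix (b : Module.Basis (Fin l) ℂ (V i)) {P : Matrix (Fin l) (Fin l) ℂ}
    (hP : IsUnit P.det) : ∃ v : Module.Basis (Fin l) ℂ (V i), b.toMatrix v = P := by
  refine ⟨b.map (Matrix.toLinearEquiv b P hP), ?_⟩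
  ext x y
  have : Matrix.toLinearEquiv b P hP (b y) = Matrix.toLin b b P (b y) := rfl
  rw [Module.Basis.toMatrix_apply, Module.Basis.map_apply, this, Matrix.toLin_self]
  simp [Finsupp.single_apply]

theorem pairBracket_toPair [Fintype (Q.LoopIndex i)] (b : Module.Basis (Fin l) ℂ (V i))
    (B : Q.RepSpace V) : pairBracket (Q.toPair b B) (Q.toPair b B) =
      LinearMap.toMatrix b b (∑ k : Q.LoopIndex i,
        (Q.barLoopMap B k * Q.loopMap B k - Q.loopMap B k * Q.barLoopMap B k)) := by
  simp [pairBracket, toPair, map_sum, LinearMap.toMatrix_mul]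

theorem symplecticForm_eq_pairForm [Fintype (Q.LoopIndex i)]
    (hV : ∀ j, j ≠ i → Subsingleton (V j)) (b : Module.Basis (Fin l) ℂ (V i))
    (B B' : Q.RepSpace V) :
    Q.symplecticForm B B' = pairForm (Q.toPair b B) (Q.toPair b B') := by
  rw [Q.symplecticForm_eq hV, pairForm]
  refine Finset.sum_congr rfl fun k _ => ?_
  simp only [toPair, LinearMap.coe_mk, AddHom.coe_mk, ← LinearMap.toMatrix_mul,
    LinearMap.trace_eq_matrix_trace ℂ b]

variable [∀ j, FiniteDimensional ℂ (V j)]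

theorem mem_nilVariety_iff_pair [Fintype (Q.LoopIndex i)] [DecidableEq (Q.LoopIndex i)]
    (hV : ∀ j, j ≠ i → Subsingleton (V j)) (b : Module.Basis (Fin l) ℂ (V i))
    (k₀ : Q.LoopIndex i) (B : Q.RepSpace V) :
    B ∈ Q.nilVariety V ↔ Q.toPair b B ∈ triangularLocus l k₀ := by
  have hl : Module.finrank ℂ (V i) = l := by simp [Module.finrank_eq_card_basis b]
  rw [Q.mem_nilVariety_iff hV hl]
  constructor
  · rintro ⟨⟨F, hF, hdim, hB⟩, hmom, hreg⟩
    -- A basis adapted to the flag that also diagonalizes the matrix at `k₀`; the other matrices are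
    -- triangular in it.
    obtain ⟨v, hv, hdiag⟩ := exists_flag_eigenbasis hl hF hdim (hB k₀).1 (hreg k₀)
    have hup : ∀ k, ((Q.toPair v B).1 k).IsUpperTriangular := fun k =>
      toMatrix_upper_of_flag hF hdim hv (hB k).1
    refine ⟨b.toMatrix v, isUnit_det_toMatrix b v, Q.toPair v B, ⟨hup, fun k =>
      toMatrix_strict_of_flag hF hdim hv (hB k).2, hdiag, ?_, fun k => ?_⟩, Q.toPair_basis b v B⟩
    · rw [pairBracket_toPair, hmom, map_zero]
    · rw [← (hup k).nodup_roots_charpoly]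
      exact (isRegularSemisimple_iff v _).1 (hreg k)
  · rintro ⟨P, hP, β, hβ, hB⟩
    obtain ⟨v, rfl⟩ := exists_basis_toMatrix b hP
    have hβ' : Q.toPair v B = β := by
      rw [Q.toPair_basis b v] at hB
      rw [← pairConj_inv hP (Q.toPair v B), hB, pairConj_inv hP]
    subst hβ'
    refine ⟨⟨basisFlag v, basisFlag_mono v, fun k hk => finrank_basisFlag v hk, fun k =>
      ⟨basisFlag_map_le v (hβ.upper k), basisFlag_map_lt v (hβ.strict k)⟩⟩, ?_, fun k => ?_⟩
    · have := hβ.moment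
      rw [pairBracket_toPair] at this
      exact (LinearMap.toMatrix v v).map_eq_zero_iff.1 this
    · rw [isRegularSemisimple_iff v]
      exact (hβ.upper k).nodup_roots_charpoly.2 (hβ.inj k)

/-- The case of a vertex without loops, in which the space of representations is zero. -/
theorem nilVariety_of_isEmpty [IsEmpty (Q.LoopIndex i)] (hV : ∀ j, j ≠ i → Subsingleton (V j))
    (b : Module.Basis (Fin l) ℂ (V i)) : IsZariskiIrreducible (Q.nilVariety V) ∧
      IsLagrangianVariety Q.symplecticForm (Q.nilVariety V) := by
  have := Fintype.ofFinite (Q.LoopIndex i)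
  have hsub : Subsingleton (Q.RepSpace V) := (Q.pairEquiv hV b).toEquiv.subsingleton
  have hne : (0 : Q.RepSpace V) ∈ Q.nilVariety V := by
    rw [Q.mem_nilVariety_iff hV (l := l) (by simp [Module.finrank_eq_card_basis b])]
    exact ⟨⟨basisFlag b, basisFlag_mono b, fun k hk => finrank_basisFlag b hk, isEmptyElim⟩,
      by simp, isEmptyElim⟩
  have hirr : IsZariskiIrreducible (Q.nilVariety V) :=
    isZariskiIrreducible_of_mul ⟨0, hne⟩ fun f _ g _ ⟨x, hx, hfx⟩ ⟨y, _, hgy⟩ =>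
      ⟨x, hx, mul_ne_zero hfx (Subsingleton.elim y x ▸ hgy)⟩
  have hdim : HasVarietyDim (Q.nilVariety V) 0 := by
    refine le_antisymm ?_ (by simp)
    -- The space of representations is a point, hence the image of the zero space, and has dimension
    -- at most `0`.
    have := trdeg_coordRing_le (T := Fin 0 → ℂ) (Z := Q.nilVariety V) (Ψ := fun _ => 0)
      (fun φ => by simp only [map_zero]; exact zero_mem (polyFun (Fin 0 → ℂ))) fun f _ hf z _ =>
        Subsingleton.elim 0 z ▸ hf 0
    simpa using this
  refine ⟨hirr, isLagrangianVariety_of_isotropic hirr hdim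
    (mul_zero 2 ▸ Module.finrank_zero_of_subsingleton.symm) fun x _ =>
    ⟨⊥, bot_le, Nat.zero_le _, fun v _ w _ => ?_⟩⟩
  rw [Q.symplecticForm_eq hV, Finset.univ_eq_empty, Finset.sum_empty]

/-- The case of a vertex with a single pair of loops. -/
theorem nilVariety_isomorphic [Unique (Q.LoopIndex i)] (hV : ∀ j, j ≠ i → Subsingleton (V j))
    (b : Module.Basis (Fin l) ℂ (V i)) : IsomorphicVarieties (Q.nilVariety V)
      {M : Matrix (Fin l) (Fin l) ℂ | IsRegularSemisimple (Matrix.toLin' M)} := by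
  classical
  have hl : Module.finrank ℂ (V i) = l := by simp [Module.finrank_eq_card_basis b]
  let e := Q.pairEquiv hV b
  let f : Q.RepSpace V →ₗ[ℂ] Matrix (Fin l) (Fin l) ℂ :=
    LinearMap.proj default ∘ₗ LinearMap.fst ℂ _ _ ∘ₗ e.toLinearMap
  let g : Matrix (Fin l) (Fin l) ℂ →ₗ[ℂ] Q.RepSpace V :=
    e.symm.toLinearMap ∘ₗ LinearMap.inl ℂ _ _ ∘ₗ LinearMap.pi fun _ => LinearMap.id
  have hfg : ∀ M, f (g M) = M := fun M => by simp [f, g]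
  have hf : ∀ B ∈ Q.nilVariety V, IsRegularSemisimple (Matrix.toLin' (f B)) := fun B hB => by
    have := ((Q.mem_nilVariety_iff hV hl B).1 hB).2.2 default
    rwa [isRegularSemisimple_iff b, ← isRegularSemisimple_toLin'_iff] at this
  have hgf : ∀ B ∈ Q.nilVariety V, g (f B) = B := fun B hB => by
    -- With a single loop of `Ω`, nothing remains of the moment map away from it, and the equation
    -- reads difference of eigenvalues times entry `= 0`.
    have h0 : (e B).2 default = 0 := by
      obtain ⟨P, hP, β, hβ, hB⟩ := (Q.mem_nilVariety_iff_pair hV b default B).1 hB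
      have hβ0 : β.2 default = 0 := by
        ext x y
        rcases lt_or_ge x y with hxy | hxy
        · have h := (pairBracket_eq_zero_iff hβ.upper hβ.strict hβ.diag).1 hβ.moment x y hxy
          have hrest : pairRest default β = 0 := by
            simp [pairRest, Finset.univ_unique]
          rw [hrest, Matrix.zero_apply, mul_eq_zero, sub_eq_zero] at h
          exact h.resolve_left fun h => hxy.ne' (hβ.inj default h)
        · exact hβ.strict _ _ _ hxy
      have : (e B).2 default = P * β.2 default * P⁻¹ := congr_fun (congr_arg Prod.snd hB) default
      rw [this, hβ0]
      simp
    refine e.symm_apply_eq.2 (Prod.ext (funext fun k => ?_) (funext fun k => ?_))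
    · rw [Unique.eq_default k]; rfl
    · rw [Unique.eq_default k, h0]; rfl
  have hg : ∀ M, IsRegularSemisimple (Matrix.toLin' M) → g M ∈ Q.nilVariety V := fun M hM => by
    have h1 : ∀ k, LinearMap.toMatrix b b (Q.barLoopMap (g M) k) = M := fun k => by
      rw [Unique.eq_default k]
      exact hfg M
    have h2 : ∀ k, Q.loopMap (g M) k = 0 := fun k => by
      have : LinearMap.toMatrix b b (Q.loopMap (g M) k) = 0 :=
        congr_fun (congr_arg Prod.snd (e.apply_symm_apply (fun _ => M, 0))) k
      exact (LinearMap.toMatrix b b).map_eq_zero_iff.1 this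
    have hreg : ∀ k, IsRegularSemisimple (Q.barLoopMap (g M) k) := fun k => by
      rwa [isRegularSemisimple_iff b, h1, ← isRegularSemisimple_toLin'_iff]
    -- The flag condition is automatic: an eigenbasis spans an invariant flag, and the zero map is
    -- strictly decreasing on any flag.
    obtain ⟨v, hv⟩ := exists_eigenbasis hl (hreg default)
    refine (Q.mem_nilVariety_iff hV hl _).2 ⟨⟨basisFlag v, basisFlag_mono v, fun k hk =>
      finrank_basisFlag v hk, fun k => ⟨?_, fun n => ?_⟩⟩, by simp [h2], hreg⟩
    · rw [Unique.eq_default k]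
      exact basisFlag_map_le v hv
    · rw [h2, Submodule.map_zero]
      exact bot_le
  exact ⟨⟨fun B => ⟨f B, hf B B.2⟩, fun M => ⟨g M, hg M M.2⟩, fun B => Subtype.ext (hgf B B.2),
    fun M => Subtype.ext (hfg M)⟩, isRegularMap_of_linear f fun _ => rfl,
    isRegularMap_of_linear g fun _ => rfl⟩

end OrientedQuiver

theorem lemma2p2 {I H : Type*} (Q : OrientedQuiver I H) (i : I) (l : ℕ) (hl : 1 ≤ l)
    (V : I → Type*) [∀ j, AddCommGroup (V j)] [∀ j, Module ℂ (V j)]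
    [∀ j, FiniteDimensional ℂ (V j)]
    (hV : ∀ j, Module.finrank ℂ (V j) = Finsupp.single i l j) :
    IsZariskiIrreducible (Q.nilVariety V) ∧
    IsLagrangianVariety Q.symplecticForm (Q.nilVariety V) ∧
    (Q.numArrows i i = 2 →
      IsomorphicVarieties (Q.nilVariety V)
        {M : Matrix (Fin l) (Fin l) ℂ | IsRegularSemisimple (Matrix.toLin' M)}) := by
  classical
  have hV' : ∀ j, j ≠ i → Subsingleton (V j) := fun j hj =>
    Module.finrank_zero_iff.1 (by rw [hV, Finsupp.single_eq_of_ne hj])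
  have hVi : Module.finrank ℂ (V i) = l := by rw [hV, Finsupp.single_eq_same]
  let b : Module.Basis (Fin l) ℂ (V i) := Module.finBasisOfFinrankEq ℂ (V i) hVi
  have hfin := Fintype.ofFinite (Q.LoopIndex i)
  rw [Q.numArrows_self, ← and_assoc]
  refine ⟨?_, fun hc => ?_⟩
  -- Normal forms require a chosen loop `k₀`; a vertex without loops is treated apart.
  · rcases isEmpty_or_nonempty (Q.LoopIndex i) with hE | ⟨⟨k₀⟩⟩
    · exact Q.nilVariety_of_isEmpty hV' b
    · have hN : Q.nilVariety V = Q.pairEquiv hV' b ⁻¹' triangularLocus l k₀ :=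
        Set.ext fun B => Q.mem_nilVariety_iff_pair hV' b k₀ B
      have hω : Q.symplecticForm = fun B B' => pairForm (Q.pairEquiv hV' b B)
          (Q.pairEquiv hV' b B') :=
        funext fun B => funext fun B' => Q.symplecticForm_eq_pairForm hV' b B B'
      rw [hN, hω]
      exact ⟨triangularLocus_irreducible k₀ _, triangularLocus_lagrangian k₀ _⟩
  · have : Unique (Q.LoopIndex i) := (Nat.card_eq_one_iff_unique.1 (by omega)).elim
      fun h h' => @Unique.mk' _ ⟨h'.some⟩ h
    exact Q.nilVariety_isomorphic hV' b
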